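/- **Setting.** Let $K$ be an even positive integer, $N_{\rm n},N_{\rm f}\ge 1$ integers, $\Omega_{\rm p},\Omega_{\rm n},\Omega_{\rm f},I,\mathscr N_0,B,T,\theta>0$, and $0<a_{\rm s}<a_{\rm w}$ with $a_{\rm s}+a_{\rm w}=2/K$. Put $\mathcal B=2B/K$, $\hat I=I/(\mathscr N_0\mathcal B)$, $\Omega=\Omega_{\rm n}\Omega_{\rm f}/(\Omega_{\rm n}+\Omega_{\rm f})$ and $\nu=\theta T\mathcal B/\ln 2$, and assume that $\nu$ is not an integer. Let $\hat h_{\rm p}$, $\hat h_{{\rm n},i}$ $(1\le i\le N_{\rm n})$ and $\hat h_{{\rm f},i}$ $(1\le i\le N_{\rm f})$ be independent $\mathcal{CN}(0,1)$ random variables, and let $g_{\rm p}=\Omega_{\rm p}|\hat h_{\rm p}|^2$, $g_{\rm n}=\sum_i\Omega_{\rm n}|\hat h_{{\rm n},i}|^2$, $g_{\rm f}=\sum_i\Omega_{\rm f}|\hat h_{{\rm f},i}|^2$. The weak user has gain $g_{\rm w}=\min\{g_{\rm n},g_{\rm f}\}$; with $X_{\rm w}=g_{\rm w}/g_{\rm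 p}$ its SINR is $\gamma_{\rm w}=a_{\rm w}\hat I X_{\rm w}/(1+a_{\rm s}\hat I X_{\rm w})$ and its effective rate is $R_{\rm w}=-\frac1\nu\log_2\mathbb E[(1+\gamma_{\rm w})^{-\nu}]$. **The G-function.** For $x,y>0$ the extended generalized bivariate Meijer G-function with all orders equal to $1$ is $$\mathcal G^{1,1:1,1:1,1}_{1,1:1,1:1,1}\left(\begin{smallmatrix}a_1\\b_1\end{smallmatrix}\Big|\begin{smallmatrix}a_2\\b_2\end{smallmatrix}\Big|\begin{smallmatrix}a_3\\b_3\end{smallmatrix}\Big|x,y\right)=\frac1{(2\pi i)^2}\int_{L}\int_{L_s}\Phi_1(s+t)\,\Phi_2(s)\,\Phi_3(t)\,x^{-s}y^{-t}\,dt\,ds,\qquad \Phi_k(z)=\Gamma(b_k+z)\,\Gamma(1-a_k-z),$$ where $L$ runs from $-i\infty$ to $+i\infty$ and separates the poles of $\Gamma(b_2+s)$ (on its left) from those of $\Gamma(1-a_2-s)$ (on its right), and, for each $s\in L$, $L_s$ is a vertical line in the $t$-plane that has the poles of $\Gamma(b_3+t)$ and $\Gamma(b_1+s+t)$ on its left and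 those of $\Gamma(1-a_3-t)$ and $\Gamma(1-a_1-s-t)$ on its right. Here $L$ is a vertical line with loops around the finitely many poles of $\Phi_2$ on its wrong side. **Theorem.** All the G-functions below are well defined (such contours exist, the integrals converge absolutely, and the value does not depend on the contours), the numbers $T_3$ below are real, the sum in the bracket is positive, and $$R_{\rm w}=-\frac1\nu\log_2\left[T_3(N_{\rm n},N_{\rm f},\Omega_{\rm n},\Omega_{\rm f})+T_3(N_{\rm f},N_{\rm n},\Omega_{\rm f},\Omega_{\rm n})\right],$$ where $$T_3(\alpha_1,\alpha_2,\beta_1,\beta_2)=\sum_{\tau=0}^{\alpha_2-1}\frac{\Omega_{\rm p}^{\alpha_1+\tau}\,(2\hat I/K)^{-(\alpha_1+\tau)}}{\Gamma(\alpha_1)\Gamma(\nu)\Gamma(-\nu)\,\beta_1^{\alpha_1}\beta_2^{\tau}\,\tau!}\;\mathcal G^{1,1:1,1:1,1}_{1,1:1,1:1,1}\left(\begin{smallmatrix}1-(\alpha_1+\tau)\\ \nu-(\alpha_1+\tau)\end{smallmatrix}\Big|\begin{smallmatrix}1+\nu\\0\end{smallmatrix}\Big|\begin{smallmatrix}-(\alpha_1+\tau)\\0\end{smallmatrix}\Big|\frac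 K2a_{\rm s},\frac{K\Omega_{\rm p}}{2\Omega\hat I}\right).$$ -/

import Mathlib

open MeasureTheory ProbabilityTheory

noncomputable section

/-! ### The extended generalized bivariate Meijer G-function -/

/-- One block of Meijer parameters of order `(m, n; p, q)`:
`aN = a₁, …, aₙ`, `aP = aₙ₊₁, …, a_p`, `bM = b₁, …, b_m`, `bQ = b_{m+1}, …, b_q`. -/
structure MeijerBlock where
  aN : List ℂ
  aP : List ℂ
  bM : List ℂ
  bQ : List ℂ

namespace MeijerBlock

/-- `Φ(s) = ∏_{j ≤ m} Γ(b_j + s) ∏_{j ≤ n} Γ(1 - a_j - s) /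
  (∏_{j > n} Γ(a_j + s) ∏_{j > m} Γ(1 - b_j - s))`. -/
def kernel (P : MeijerBlock) (s : ℂ) : ℂ :=
  (P.bM.map fun b => Complex.Gamma (b + s)).prod *
      (P.aN.map fun a => Complex.Gamma (1 - a - s)).prod /
    ((P.aP.map fun a => Complex.Gamma (a + s)).prod *
      (P.bQ.map fun b => Complex.Gamma (1 - b - s)).prod)

/-- The poles of the factors `Γ(b_j + s)`, `j ≤ m`. -/
def leftPoles (P : MeijerBlock) : Set ℂ := {p | ∃ b ∈ P.bM, ∃ k : ℕ, p = -b - k}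

/-- The poles of the factors `Γ(1 - a_j - s)`, `j ≤ n`. -/
def rightPoles (P : MeijerBlock) : Set ℂ := {p | ∃ a ∈ P.aN, ∃ k : ℕ, p = 1 - a + k}

end MeijerBlock

/-- Contours for the iterated Mellin–Barnes integral `∫ ds ∫ dt`. The `s`-contour is the upward line
`Re s = c` deformed so that it separates the left from the right poles of the `s`-block: it is the
cycle made of that line and of circles of radius `r` around the finitely many poles that are on the
wrong side of the line. For `s` on it, the `t`-contour is the upward line `Re t = d s`. -/
structure BarnesContour where
  c : ℝ
  r : ℝ
  d : ℂ → ℝ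

namespace BarnesContour

variable (C : BarnesContour) (P₁ P₂ P₃ : MeijerBlock) (x y : ℝ)

/-- The left poles of the `s`-block to the right of the line `Re s = c`. -/
def wrongLeft : Set ℂ := {p | p ∈ P₂.leftPoles ∧ C.c < p.re}

/-- The right poles of the `s`-block to the left of the line `Re s = c`. -/
def wrongRight : Set ℂ := {p | p ∈ P₂.rightPoles ∧ p.re < C.c}

/-- The points of the `s`-contour. -/
def support : Set ℂ :=
  {s | s.re = C.c ∨ ∃ p ∈ C.wrongLeft P₂ ∪ C.wrongRight P₂, dist s p = C.r}

/-- The contours separate the left from the right poles of all the Gamma factors of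
`Φ₁(s + t) Φ₂(s) Φ₃(t)`. -/
structure Admissible : Prop where
  r_pos : 0 < C.r
  disjoint : Disjoint P₂.leftPoles P₂.rightPoles
  line : ∀ p ∈ P₂.leftPoles ∪ P₂.rightPoles, p.re ≠ C.c
  circle_line : ∀ p ∈ C.wrongLeft P₂ ∪ C.wrongRight P₂, C.r < |p.re - C.c|
  circle_pole : ∀ p ∈ C.wrongLeft P₂ ∪ C.wrongRight P₂,
    ∀ q ∈ P₂.leftPoles ∪ P₂.rightPoles, q ≠ p → C.r < dist q p
  left_t : ∀ s ∈ C.support P₂, ∀ p ∈ P₃.leftPoles, p.re < C.d s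
  right_t : ∀ s ∈ C.support P₂, ∀ p ∈ P₃.rightPoles, C.d s < p.re
  left_st : ∀ s ∈ C.support P₂, ∀ p ∈ P₁.leftPoles, p.re < s.re + C.d s
  right_st : ∀ s ∈ C.support P₂, ∀ p ∈ P₁.rightPoles, s.re + C.d s < p.re

/-- `u ↦ Φ₁(s + t) Φ₃(t) y⁻ᵗ` at `t = d s + i u`. -/
def innerIntegrand (s : ℂ) (u : ℝ) : ℂ :=
  P₁.kernel (s + (C.d s + u * Complex.I)) * P₃.kernel (C.d s + u * Complex.I) *
    (y : ℂ) ^ (-(C.d s + u * Complex.I))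

/-- `Φ₂(s) x⁻ˢ (2πi)⁻¹ ∫ Φ₁(s + t) Φ₃(t) y⁻ᵗ dt`. -/
def outerIntegrand (s : ℂ) : ℂ :=
  P₂.kernel s * (x : ℂ) ^ (-s) *
    ((2 * Real.pi : ℂ)⁻¹ * ∫ u : ℝ, C.innerIntegrand P₁ P₃ y s u)

/-- All the integrals that make up `value` converge absolutely. -/
structure Converges : Prop where
  inner : ∀ s ∈ C.support P₂, Integrable (C.innerIntegrand P₁ P₃ y s)
  line : Integrable fun u : ℝ => C.outerIntegrand P₁ P₂ P₃ x y (C.c + u * Complex.I)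
  circle : ∀ p ∈ C.wrongLeft P₂ ∪ C.wrongRight P₂,
    CircleIntegrable (C.outerIntegrand P₁ P₂ P₃ x y) p C.r

/-- The contribution of the circle around `p`, oriented counterclockwise. -/
def loop (p : ℂ) : ℂ :=
  (2 * Real.pi * Complex.I)⁻¹ * (∮ z in C(p, C.r), C.outerIntegrand P₁ P₂ P₃ x y z)

/-- `(2πi)⁻² ∫ ∫ Φ₁(s + t) Φ₂(s) Φ₃(t) x⁻ˢ y⁻ᵗ dt ds` along the contours. A left pole on the wrong
side of the line is circled counterclockwise, a right pole clockwise. -/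
def value : ℂ :=
  (2 * Real.pi : ℂ)⁻¹ * (∫ u : ℝ, C.outerIntegrand P₁ P₂ P₃ x y (C.c + u * Complex.I))
    + (∑ᶠ p ∈ C.wrongLeft P₂, C.loop P₁ P₂ P₃ x y p)
    - (∑ᶠ p ∈ C.wrongRight P₂, C.loop P₁ P₂ P₃ x y p)

end BarnesContour

/-- `v` is the value at `(x, y)` of the extended generalized bivariate Meijer G-function with parameter
blocks `P₁` (for `s + t`), `P₂` (for `s`), `P₃` (for `t`): admissible contours exist, and along each
of them the double Mellin–Barnes integral converges to `v`. -/
def IsEGBMGF (P₁ P₂ P₃ : MeijerBlock) (x y : ℝ) (v : ℂ) : Prop :=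
  (∃ C : BarnesContour, C.Admissible P₁ P₂ P₃) ∧
    ∀ C : BarnesContour, C.Admissible P₁ P₂ P₃ →
      C.Converges P₁ P₂ P₃ x y ∧ C.value P₁ P₂ P₃ x y = v

open Classical in
/-- The extended generalized bivariate Meijer G-function (`0` where it is not defined). -/
def egbmgf (P₁ P₂ P₃ : MeijerBlock) (x y : ℝ) : ℂ :=
  if h : ∃ v, IsEGBMGF P₁ P₂ P₃ x y v then h.choose else 0

/-- The block of order `(1, 1; 1, 1)` with upper parameter `a` and lower parameter `b`. -/
def block11 (a b : ℝ) : MeijerBlock := ⟨[(a : ℂ)], [], [(b : ℂ)], []⟩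

/-! ### The system -/

/-- The circularly symmetric complex Gaussian law `𝒞𝒩(0, 1)`. -/
def stdComplexGaussian : Measure ℂ :=
  ((gaussianReal 0 (1 / 2)).prod (gaussianReal 0 (1 / 2))).map Complex.measurableEquivRealProd.symm

/-- Parameters of a user pair of the underlay NOMA downlink: number `K` of users, numbers `Nn`, `Nf` of
antennas of the near and the far user, path losses `Ωp`, `Ωn`, `Ωf`, peak interference power `I`,
noise density `N₀`, total bandwidth `B`, block length `T`, delay exponent `θ`, power allocation
coefficients `aₛ`, `a_w` of the strong and the weak user. -/
structure NOMAParams where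
  K : ℕ
  Nn : ℕ
  Nf : ℕ
  Ωp : ℝ
  Ωn : ℝ
  Ωf : ℝ
  I : ℝ
  N₀ : ℝ
  B : ℝ
  T : ℝ
  θ : ℝ
  as : ℝ
  aw : ℝ
  K_pos : 0 < K
  K_even : Even K
  Nn_pos : 1 ≤ Nn
  Nf_pos : 1 ≤ Nf
  Ωp_pos : 0 < Ωp
  Ωn_pos : 0 < Ωn
  Ωf_pos : 0 < Ωf
  I_pos : 0 < I
  N₀_pos : 0 < N₀
  B_pos : 0 < B
  T_pos : 0 < T
  θ_pos : 0 < θ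
  as_pos : 0 < as
  as_lt_aw : as < aw
  as_add_aw : as + aw = 2 / K

namespace NOMAParams

variable (S : NOMAParams)

/-- The bandwidth of the user pair. -/
def pairBandwidth : ℝ := 2 * S.B / S.K

/-- `ν = θ T 𝓑 / ln 2`. -/
def ν : ℝ := S.θ * S.T * S.pairBandwidth / Real.log 2

/-- `Î = I / (N₀ 𝓑)`. -/
def Ihat : ℝ := S.I / (S.N₀ * S.pairBandwidth)

/-- `Ω = Ωn Ωf / (Ωn + Ωf)`. -/
def Ω : ℝ := S.Ωn * S.Ωf / (S.Ωn + S.Ωf)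

/-- First parameter block of the G-function in the `τ`-th term of `T₃`, where `a = α₁ + τ`. -/
def blk₁ (a : ℕ) : MeijerBlock := block11 (1 - a) (S.ν - a)

/-- Its second parameter block. -/
def blk₂ : MeijerBlock := block11 (1 + S.ν) 0

/-- Its third parameter block. -/
def blk₃ (a : ℕ) : MeijerBlock := block11 (-a) 0

/-- Its first argument. -/
def argX : ℝ := S.K / 2 * S.as

/-- Its second argument. -/
def argY : ℝ := S.K * S.Ωp / (2 * S.Ω * S.Ihat)

def T₃ (α₁ α₂ : ℕ) (β₁ β₂ : ℝ) : ℂ :=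
  ∑ τ ∈ Finset.range α₂,
    ((S.Ωp ^ (α₁ + τ) * ((2 * S.Ihat / S.K) ^ (α₁ + τ))⁻¹ /
      (Real.Gamma α₁ * Real.Gamma S.ν * Real.Gamma (-S.ν) * β₁ ^ α₁ * β₂ ^ τ * τ.factorial) : ℝ) : ℂ) *
    egbmgf (S.blk₁ (α₁ + τ)) S.blk₂ (NOMAParams.blk₃ (α₁ + τ)) S.argX S.argY

end NOMAParams

/-- The normalized fading coefficients of the links from the secondary transmitter to the primary
receiver (`hp`) and to the antennas of the near (`hn`) and the far (`hf`) user: independent, with law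
`𝒞𝒩(0, 1)` (Rayleigh fading). -/
structure RayleighFading (S : NOMAParams) {E : Type*} [MeasurableSpace E] (μ : Measure E) where
  hp : E → ℂ
  hn : Fin S.Nn → E → ℂ
  hf : Fin S.Nf → E → ℂ
  law_hp : HasLaw hp stdComplexGaussian μ
  law_hn : ∀ i, HasLaw (hn i) stdComplexGaussian μ
  law_hf : ∀ i, HasLaw (hf i) stdComplexGaussian μ
  indep : iIndepFun (fun j : Unit ⊕ (Fin S.Nn ⊕ Fin S.Nf) =>
    Sum.elim (fun _ => hp) (Sum.elim hn hf) j) μ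

namespace RayleighFading

variable {S : NOMAParams} {E : Type*} [MeasurableSpace E] {μ : Measure E} (F : RayleighFading S μ)

/-- Channel gain of the interference link. -/
def gp (ω : E) : ℝ := ‖(Real.sqrt S.Ωp : ℂ) * F.hp ω‖ ^ 2

/-- Combined channel gain of the near user. -/
def gn (ω : E) : ℝ := ∑ i, ‖(Real.sqrt S.Ωn : ℂ) * F.hn i ω‖ ^ 2

/-- Combined channel gain of the far user. -/
def gf (ω : E) : ℝ := ∑ i, ‖(Real.sqrt S.Ωf : ℂ) * F.hf i ω‖ ^ 2

/-- Channel gain of the weak user, the user of the pair with the smaller gain. -/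
def gw (ω : E) : ℝ := min (F.gn ω) (F.gf ω)

/-- SINR of the weak user, at transmit power `I / g_p`. -/
def γw (ω : E) : ℝ :=
  S.aw * S.I * F.gw ω / F.gp ω / (S.N₀ * S.pairBandwidth + S.as * S.I * F.gw ω / F.gp ω)

/-- Effective rate of the weak user, `-(1/ν) log₂ 𝔼[(1 + γ_w)^(-ν)]`. -/
def Rw : ℝ := -1 / S.ν * Real.logb 2 (∫ ω, (1 + F.γw ω) ^ (-S.ν) ∂μ)

end RayleighFading

end

/-
For fixed `s` the inner `t`-integral is, by Parseval's formula, the Mellin transform in `s` of a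
product of two univariate functions `G^{1,1}_{1,1}`, each of which is a gamma factor times a power
of `u` times a power of `1 + u`. The vertical `s`-integral together with the residues at the circled
poles is again a univariate `G^{1,1}_{1,1}`: multiplied by `u ^ (-b)` and differentiated in `u`, the
line integral and the function minus those residues both pass to the parameter `b + 1`, which has
one circled pole less, and both vanish at `u = 0`. Hence the bivariate G-function is a Mellin
convolution over `(0, ∞)` of elementary functions.

On the probabilistic side the three gains have gamma laws. Splitting on which of `g_n`, `g_f` is the
smaller one and expanding the tail of the other as an Erlang sum, `g_p / g_w` becomes a mixture,
with negative binomial weights, of Lomax laws, and the expectation of `(1 + γ_w) ^ (-ν)` under each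
of them is the convolution above up to a constant factor.
-/

noncomputable section

open Complex Set Filter Topology

/-- The line `Re s = c` avoids the poles of the Gamma factors in the numerator of `P.kernel`. -/
def MeijerBlock.AvoidsPoles (P : MeijerBlock) (c : ℝ) : Prop :=
  ∀ p ∈ P.leftPoles ∪ P.rightPoles, p.re ≠ c

section Kernel

variable {a b c : ℝ}

lemma block11_kernel (a b : ℝ) (s : ℂ) :
    (block11 a b).kernel s = Gamma (b + s) * Gamma (1 - a - s) := by
  simp [MeijerBlock.kernel, block11]

lemma mem_block11_leftPoles {p : ℂ} : p ∈ (block11 a b).leftPoles ↔ ∃ k : ℕ, p = -b - k := by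
  simp [MeijerBlock.leftPoles, block11]

lemma mem_block11_rightPoles {p : ℂ} :
    p ∈ (block11 a b).rightPoles ↔ ∃ k : ℕ, p = 1 - a + k := by
  simp [MeijerBlock.rightPoles, block11]

lemma block11_avoidsPoles_iff :
    (block11 a b).AvoidsPoles c ↔ (∀ k : ℕ, b + c ≠ -k) ∧ ∀ k : ℕ, 1 - a - c ≠ -k := by
  simp only [MeijerBlock.AvoidsPoles, mem_union, mem_block11_leftPoles, mem_block11_rightPoles]
  refine ⟨fun h => ⟨fun k hk => h (-b - k) (.inl ⟨k, rfl⟩) ?_,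
    fun k hk => h (1 - a + k) (.inr ⟨k, rfl⟩) ?_⟩, ?_⟩
  · simp only [sub_re, neg_re, ofReal_re, natCast_re]
    linarith
  · simp only [sub_re, add_re, one_re, ofReal_re, natCast_re]
    linarith
  · rintro ⟨hl, hr⟩ p (⟨k, rfl⟩ | ⟨k, rfl⟩) hp
    · simp only [sub_re, neg_re, ofReal_re, natCast_re] at hp
      exact hl k (by linarith)
    · simp only [sub_re, add_re, one_re, ofReal_re, natCast_re] at hp
      exact hr k (by linarith)

lemma block11_avoidsPoles_of_mem_strip (hb : -b < c) (ha : c < 1 - a) :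
    (block11 a b).AvoidsPoles c := by
  refine block11_avoidsPoles_iff.2 ⟨fun k hk => ?_, fun k hk => ?_⟩ <;>
  · have := k.cast_nonneg (α := ℝ)
    linarith

lemma MeijerBlock.AvoidsPoles.raise_lower (h : (block11 a b).AvoidsPoles c) :
    (block11 a (b + 1)).AvoidsPoles c := by
  rw [block11_avoidsPoles_iff] at h ⊢
  refine ⟨fun k hk => h.1 (k + 1) ?_, h.2⟩
  push_cast
  linarith

lemma MeijerBlock.AvoidsPoles.lower_upper (h : (block11 a b).AvoidsPoles c) :
    (block11 (a - 1) b).AvoidsPoles c := by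
  rw [block11_avoidsPoles_iff] at h ⊢
  refine ⟨h.1, fun k hk => h.2 (k + 1) ?_⟩
  push_cast
  linarith

lemma MeijerBlock.AvoidsPoles.reflect (h : (block11 a b).AvoidsPoles c) :
    (block11 (1 - b) (1 - a)).AvoidsPoles (-c) := by
  rw [block11_avoidsPoles_iff] at h ⊢
  refine ⟨fun k hk => h.2 k ?_, fun k hk => h.1 k ?_⟩ <;> linarith

lemma MeijerBlock.AvoidsPoles.add_ne_zero (h : (block11 a b).AvoidsPoles c) (u : ℝ) :
    (b : ℂ) + (c + u * I) ≠ 0 := fun h0 =>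
  (block11_avoidsPoles_iff.1 h).1 0 (by simpa using congrArg re h0)

lemma MeijerBlock.AvoidsPoles.sub_ne_zero (h : (block11 a b).AvoidsPoles c) (u : ℝ) :
    (1 : ℂ) - a - (c + u * I) ≠ 0 := fun h0 =>
  (block11_avoidsPoles_iff.1 h).2 0 (by simpa using congrArg re h0)

lemma block11_kernel_raise_lower (a b : ℝ) {s : ℂ} (hs : (b : ℂ) + s ≠ 0) :
    (block11 a (b + 1)).kernel s = (b + s) * (block11 a b).kernel s := by
  rw [block11_kernel, block11_kernel, ofReal_add, ofReal_one, add_right_comm, Gamma_add_one _ hs,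
    mul_assoc]

lemma block11_kernel_lower_upper (a b : ℝ) {s : ℂ} (hs : (1 : ℂ) - a - s ≠ 0) :
    (block11 (a - 1) b).kernel s = (1 - a - s) * (block11 a b).kernel s := by
  rw [block11_kernel, block11_kernel, mul_left_comm, ← Gamma_add_one _ hs]
  congr 2
  push_cast
  ring

lemma block11_kernel_neg (a b : ℝ) (s : ℂ) :
    (block11 a b).kernel (-s) = (block11 (1 - b) (1 - a)).kernel s := by
  simp only [block11_kernel, ofReal_sub, ofReal_one, sub_sub_cancel, sub_neg_eq_add]
  rw [mul_comm, ← sub_eq_add_neg]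

lemma differentiableAt_block11_kernel {s : ℂ}
    (hs : s ∉ (block11 a b).leftPoles ∪ (block11 a b).rightPoles) :
    DifferentiableAt ℂ (block11 a b).kernel s := by
  simp only [mem_union, mem_block11_leftPoles, mem_block11_rightPoles, not_or, not_exists] at hs
  rw [funext (block11_kernel a b)]
  refine DifferentiableAt.mul ?_ ?_
  · exact (differentiableAt_Gamma _ fun k hk => hs.1 k (by linear_combination hk)).comp s
      (f := fun z : ℂ => b + z) (by fun_prop)
  · exact (differentiableAt_Gamma _ fun k hk => hs.2 k (by linear_combination -hk)).comp s
      (f := fun z : ℂ => 1 - a - z) (by fun_prop)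

lemma continuous_block11_kernel_line (h : (block11 a b).AvoidsPoles c) :
    Continuous fun u : ℝ => (block11 a b).kernel (c + u * I) :=
  continuous_iff_continuousAt.2 fun u =>
    ContinuousAt.comp (f := fun u : ℝ => (c + u * I : ℂ))
      (differentiableAt_block11_kernel fun hu => h _ hu (by simp)).continuousAt (by fun_prop)

lemma norm_Gamma_le {s : ℂ} (hs : 0 < s.re) : ‖Gamma s‖ ≤ Real.Gamma s.re := by
  rw [Gamma_eq_integral hs, Real.Gamma_eq_integral hs, GammaIntegral]
  refine (norm_integral_le_integral_norm _).trans_eq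
    (setIntegral_congr_fun measurableSet_Ioi fun x hx => ?_)
  simp only [norm_mul, norm_real, Real.norm_eq_abs, Real.abs_exp, norm_cpow_eq_rpow_re_of_pos hx,
    sub_re, one_re]

lemma norm_block11_kernel_le {s : ℂ} (hb : -b < s.re) (ha : s.re < 1 - a) :
    ‖(block11 a b).kernel s‖ ≤ Real.Gamma (b + s.re) * Real.Gamma (1 - a - s.re) := by
  rw [block11_kernel, norm_mul]
  have hleft := norm_Gamma_le (s := b + s) (by simp only [add_re, ofReal_re]; linarith)
  have hright := norm_Gamma_le (s := 1 - a - s)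
    (by simp only [sub_re, one_re, ofReal_re]; linarith)
  simp only [add_re, sub_re, one_re, ofReal_re] at hleft hright
  exact mul_le_mul hleft hright (norm_nonneg _) (Real.Gamma_pos_of_pos (by linarith)).le

lemma min_one_abs_mul_sqrt_le_norm (p u : ℝ) :
    min 1 |p| * √(1 + u ^ 2) ≤ ‖(p + u * I : ℂ)‖ := by
  have hsq : min 1 |p| ^ 2 ≤ p ^ 2 := by
    rw [← sq_abs p]
    gcongr
    exact min_le_right _ _
  have hone : min 1 |p| ^ 2 ≤ 1 := pow_le_one₀ (by positivity) (min_le_left _ _)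
  rw [norm_add_mul_I, ← Real.sqrt_sq (by positivity : 0 ≤ min 1 |p|), ← Real.sqrt_mul (sq_nonneg _)]
  refine Real.sqrt_le_sqrt ?_
  nlinarith [sq_nonneg u]

-- Each Gamma factor is pushed one step to the right by its functional equation, which gains a
-- linear factor in the imaginary part.
lemma exists_kernel_line_decay_of_bounded (h : (block11 a b).AvoidsPoles c)
    (hb : ∃ C, ∀ u : ℝ, ‖(block11 (a - 1) (b + 1)).kernel (c + u * I)‖ ≤ C) :
    ∃ C, ∀ u : ℝ, ‖(block11 a b).kernel (c + u * I)‖ ≤ C * (1 + u ^ 2)⁻¹ := by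
  obtain ⟨C, hC⟩ := hb
  have hp : b + c ≠ 0 := by simpa using (block11_avoidsPoles_iff.1 h).1 0
  have hq : 1 - a - c ≠ 0 := by simpa using (block11_avoidsPoles_iff.1 h).2 0
  set m := min 1 |b + c|
  set n := min 1 |1 - a - c|
  have : 0 < m := lt_min one_pos (abs_pos.2 hp)
  have : 0 < n := lt_min one_pos (abs_pos.2 hq)
  refine ⟨C / (m * n), fun u => ?_⟩
  set s : ℂ := c + u * I with hs
  have hshift : (block11 (a - 1) (b + 1)).kernel s
      = (1 - a - s) * ((b + s) * (block11 a b).kernel s) := by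
    rw [block11_kernel_lower_upper _ _ (h.raise_lower.sub_ne_zero u),
      block11_kernel_raise_lower _ _ (h.add_ne_zero u)]
  have hleft : m * √(1 + u ^ 2) ≤ ‖(b : ℂ) + s‖ := by
    convert! min_one_abs_mul_sqrt_le_norm (b + c) u using 2
    simp only [hs, ofReal_add]
    ring
  have hright : n * √(1 + u ^ 2) ≤ ‖(1 : ℂ) - a - s‖ := by
    convert! min_one_abs_mul_sqrt_le_norm (1 - a - c) (-u) using 2
    · rw [neg_sq]
    · simp only [hs, ofReal_sub, ofReal_neg, ofReal_one]
      ring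
  rw [← div_eq_mul_inv, div_div, le_div_iff₀ (by positivity)]
  calc ‖(block11 a b).kernel s‖ * (m * n * (1 + u ^ 2))
      = (n * √(1 + u ^ 2)) * ((m * √(1 + u ^ 2)) * ‖(block11 a b).kernel s‖) := by
        nth_rewrite 1 [← Real.sq_sqrt (by positivity : 0 ≤ 1 + u ^ 2)]
        ring
    _ ≤ ‖(1 : ℂ) - a - s‖ * (‖(b : ℂ) + s‖ * ‖(block11 a b).kernel s‖) := by gcongr
    _ = ‖(block11 (a - 1) (b + 1)).kernel s‖ := by rw [hshift, norm_mul, norm_mul]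
    _ ≤ C := hC u

lemma exists_kernel_line_decay_of_mem_enlarged_strip (n : ℕ) :
    ∀ {a b c : ℝ}, (block11 a b).AvoidsPoles c → -b - n < c → c < 1 - a + n →
      ∃ C, ∀ u : ℝ, ‖(block11 a b).kernel (c + u * I)‖ ≤ C * (1 + u ^ 2)⁻¹ := by
  induction n with
  | zero =>
    intro a b c h hb ha
    rw [Nat.cast_zero] at hb ha
    refine exists_kernel_line_decay_of_bounded h
      ⟨Real.Gamma (b + 1 + c) * Real.Gamma (1 - (a - 1) - c), fun u => ?_⟩
    have hre : ((c : ℂ) + u * I).re = c := by simp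
    have hle := norm_block11_kernel_le (a := a - 1) (b := b + 1) (s := c + u * I)
      (by linarith) (by linarith)
    rwa [hre] at hle
  | succ n ih =>
    intro a b c h hb ha
    push_cast at hb ha
    obtain ⟨C, hC⟩ := ih h.raise_lower.lower_upper (by linarith) (by linarith)
    refine exists_kernel_line_decay_of_bounded h ⟨C, fun u => (hC u).trans ?_⟩
    have hC0 : 0 ≤ C := by simpa using (norm_nonneg _).trans (hC 0)
    exact mul_le_of_le_one_right hC0 (inv_le_one_of_one_le₀ (by nlinarith [sq_nonneg u]))

lemma exists_kernel_line_decay (h : (block11 a b).AvoidsPoles c) :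
    ∃ C, ∀ u : ℝ, ‖(block11 a b).kernel (c + u * I)‖ ≤ C * (1 + u ^ 2)⁻¹ := by
  obtain ⟨n, hn⟩ := exists_nat_gt (max (-b - c) (c - (1 - a)))
  rw [max_lt_iff] at hn
  exact exists_kernel_line_decay_of_mem_enlarged_strip n h (by linarith) (by linarith)

lemma integrable_kernel_line (h : (block11 a b).AvoidsPoles c) :
    Integrable fun u : ℝ => (block11 a b).kernel (c + u * I) := by
  obtain ⟨C, hC⟩ := exists_kernel_line_decay h
  exact (integrable_inv_one_add_sq.const_mul C).mono'
    (continuous_block11_kernel_line h).aestronglyMeasurable (ae_of_all _ hC)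

end Kernel

section MeijerG11

/-- The univariate Meijer function `G^{1,1}_{1,1}(X | a; b)`, in closed form; by Mellin inversion it
is the Mellin–Barnes integral of `(block11 a b).kernel` along a line that separates the poles. -/
def meijerG11 (a b X : ℝ) : ℝ := Real.Gamma (1 - a + b) * X ^ b * (1 + X) ^ (-(1 - a + b))

variable {a b : ℝ}

lemma continuousOn_meijerG11 (a b : ℝ) :
    ContinuousOn (fun X => (meijerG11 a b X : ℂ)) (Ioi 0) := by
  refine continuous_ofReal.comp_continuousOn ((continuousOn_const.mul ?_).mul ?_)
  · exact continuousOn_id.rpow_const fun X hX => .inl (ne_of_gt hX)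
  · refine ContinuousOn.rpow_const (by fun_prop) fun X (hX : 0 < X) => .inl ?_
    positivity

lemma meijerG11_reflect (a b : ℝ) {X : ℝ} (hX : 0 < X) :
    meijerG11 (1 - b) (1 - a) X⁻¹ = meijerG11 a b X := by
  have hsum : 1 + X⁻¹ = (1 + X) * X⁻¹ := by
    field_simp
    ring
  have hexp : 1 - (1 - b) + (1 - a) = 1 - a + b := by ring
  have hpow : X ^ (-(1 - a)) * X ^ (- -(1 - a + b)) = X ^ b := by
    rw [← Real.rpow_add hX]
    congr 1
    ring
  rw [meijerG11, meijerG11, hexp, hsum, Real.mul_rpow (by positivity) (by positivity),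
    Real.inv_rpow hX.le, Real.inv_rpow hX.le, ← Real.rpow_neg hX.le, ← Real.rpow_neg hX.le]
  linear_combination Real.Gamma (1 - a + b) * (1 + X) ^ (-(1 - a + b)) * hpow

lemma abs_meijerG11_le (hab : a < 1 + b) {X : ℝ} (hX : 0 < X) :
    |meijerG11 a b X| ≤ Real.Gamma (1 - a + b) * X ^ b := by
  have hG := Real.Gamma_pos_of_pos (show 0 < 1 - a + b by linarith)
  rw [abs_of_nonneg (by rw [meijerG11]; positivity), meijerG11]
  exact mul_le_of_le_one_right (by positivity)
    (Real.rpow_le_one_of_one_le_of_nonpos (by linarith) (by linarith))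

lemma meijerG11_isBigO_zero (hab : a < 1 + b) :
    (fun X => (meijerG11 a b X : ℂ)) =O[𝓝[>] 0] (· ^ b) := by
  refine .of_bound (Real.Gamma (1 - a + b)) ?_
  filter_upwards [self_mem_nhdsWithin] with X (hX : 0 < X)
  rw [norm_real, Real.norm_of_nonneg (Real.rpow_nonneg hX.le _)]
  exact abs_meijerG11_le hab hX

lemma meijerG11_isBigO_atTop (hab : a < 1 + b) :
    (fun X => (meijerG11 a b X : ℂ)) =O[atTop] (· ^ (a - 1)) := by
  have hzero := (meijerG11_isBigO_zero (a := 1 - b) (b := 1 - a) (by linarith)).comp_tendsto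
    tendsto_inv_atTop_nhdsGT_zero
  refine hzero.congr' ?_ ?_ <;> filter_upwards [eventually_gt_atTop 0] with X hX
  · rw [Function.comp_apply, meijerG11_reflect a b hX]
  · rw [Function.comp_apply, Real.inv_rpow hX.le, ← Real.rpow_neg hX.le, neg_sub]

lemma mellinConvergent_meijerG11 {s : ℂ} (hb : -b < s.re) (ha : s.re < 1 - a) :
    MellinConvergent (fun X => (meijerG11 a b X : ℂ)) s :=
  mellinConvergent_of_isBigO_rpow
    ((continuousOn_meijerG11 a b).locallyIntegrableOn measurableSet_Ioi)
    (by simpa using meijerG11_isBigO_atTop (a := a) (b := b) (by linarith)) ha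
    (by simpa using meijerG11_isBigO_zero (a := a) (b := b) (by linarith)) hb

lemma image_div_one_add_Ioi_zero : (fun x : ℝ => x / (1 + x)) '' Ioi 0 = Ioo 0 1 := by
  ext t
  constructor
  · rintro ⟨x, hx : 0 < x, rfl⟩
    exact ⟨by positivity, by rw [div_lt_one (by positivity)]; linarith⟩
  · rintro ⟨ht0, ht1⟩
    have : 0 < 1 - t := by linarith
    refine ⟨t / (1 - t), div_pos ht0 this, ?_⟩
    field_simp
    ring

lemma injOn_div_one_add_Ioi_zero : InjOn (fun x : ℝ => x / (1 + x)) (Ioi 0) := by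
  intro x (hx : 0 < x) y (hy : 0 < y) hxy
  rw [div_eq_div_iff (by positivity) (by positivity)] at hxy
  linarith

lemma hasDerivAt_div_one_add {x : ℝ} (hx : 0 < 1 + x) :
    HasDerivAt (fun x : ℝ => x / (1 + x)) ((1 + x) ^ 2)⁻¹ x := by
  convert! (hasDerivAt_id x).div ((hasDerivAt_id x).const_add 1) hx.ne' using 1
  simp

lemma ofReal_div_cpow {x y : ℝ} (hx : 0 ≤ x) (hy : 0 < y) (s : ℂ) :
    ((x / y : ℝ) : ℂ) ^ s = (x : ℂ) ^ s * (y : ℂ) ^ (-s) := by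
  rw [div_eq_mul_inv, ofReal_mul, mul_cpow_ofReal_nonneg hx (by positivity), ofReal_inv,
    inv_cpow _ _ (by rw [arg_ofReal_of_nonneg hy.le]; exact Real.pi_pos.ne), cpow_neg]

-- The substitution `t = x / (1 + x)` in the Beta integral.
lemma mellin_one_add_cpow_neg (m s : ℂ) :
    mellin (fun x : ℝ => ((1 + x : ℝ) : ℂ) ^ (-m)) s = betaIntegral s (m - s) := by
  rw [betaIntegral, intervalIntegral.integral_of_le zero_le_one, integral_Ioc_eq_integral_Ioo,
    ← image_div_one_add_Ioi_zero, integral_image_eq_integral_abs_deriv_smul measurableSet_Ioi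
      (fun x (hx : 0 < x) => (hasDerivAt_div_one_add (by positivity)).hasDerivWithinAt)
      injOn_div_one_add_Ioi_zero, mellin]
  refine setIntegral_congr_fun measurableSet_Ioi fun x (hx : 0 < x) => ?_
  have hx1 : 0 < 1 + x := by positivity
  have hne : ((1 + x : ℝ) : ℂ) ≠ 0 := ofReal_ne_zero.2 hx1.ne'
  have hcompl : (1 : ℂ) - ((x / (1 + x) : ℝ) : ℂ) = (1 / (1 + x) : ℝ) := by
    rw [← ofReal_one, ← ofReal_sub]
    congr 1
    field_simp
    ring
  have hjac : ((((1 + x) ^ 2)⁻¹ : ℝ) : ℂ) = ((1 + x : ℝ) : ℂ) ^ (-2 : ℂ) := by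
    rw [cpow_neg]
    push_cast
    norm_cast
  have hcombine : ((1 + x : ℝ) : ℂ) ^ (-m) = ((1 + x : ℝ) : ℂ) ^ (-2 : ℂ) *
      ((1 + x : ℝ) : ℂ) ^ (-(s - 1)) * ((1 + x : ℝ) : ℂ) ^ (-(m - s - 1)) := by
    rw [← cpow_add _ _ hne, ← cpow_add _ _ hne]
    congr 1
    ring
  simp only [smul_eq_mul, real_smul]
  rw [hcompl, ofReal_div_cpow hx.le hx1, ofReal_div_cpow zero_le_one hx1,
    abs_of_pos (by positivity), hjac, hcombine, ofReal_one, one_cpow]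
  ring

lemma mellin_meijerG11 {s : ℂ} (hb : -b < s.re) (ha : s.re < 1 - a) :
    mellin (fun X => (meijerG11 a b X : ℂ)) s = (block11 a b).kernel s := by
  have hcast : ∀ X ∈ Ioi (0 : ℝ), (meijerG11 a b X : ℂ) = (X : ℂ) ^ (b : ℂ) •
      (Gamma ((1 - a + b : ℝ) : ℂ) • ((1 + X : ℝ) : ℂ) ^ (-((1 - a + b : ℝ) : ℂ))) := by
    intro X (hX : 0 < X)
    rw [meijerG11, ofReal_mul, ofReal_mul, ← Gamma_ofReal, ofReal_cpow hX.le,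
      ofReal_cpow (by positivity), ofReal_neg, smul_eq_mul, smul_eq_mul]
    ring
  have hbeta := Gamma_mul_Gamma_eq_betaIntegral (s := b + s) (t := 1 - a - s)
    (by simp only [add_re, ofReal_re]; linarith)
    (by simp only [sub_re, one_re, ofReal_re]; linarith)
  rw [mellin, setIntegral_congr_fun measurableSet_Ioi fun X hX => by rw [hcast X hX], ← mellin,
    mellin_cpow_smul, mellin_const_smul, mellin_one_add_cpow_neg, block11_kernel, hbeta,
    smul_eq_mul]
  congr 2 <;> push_cast <;> ring

end MeijerG11

section VerticalLine

variable {a b c X : ℝ}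

lemma mellinInv_eq_mul_integral (c : ℝ) (φ : ℂ → ℂ) (X : ℝ) :
    mellinInv c φ X =
      (2 * Real.pi : ℂ)⁻¹ * ∫ u : ℝ, φ (c + u * I) * (X : ℂ) ^ (-(c + u * I : ℂ)) := by
  simp only [mellinInv, smul_eq_mul, real_smul, mul_comm (φ _)]
  push_cast
  rw [one_div]

lemma norm_cpow_neg_line (hX : 0 < X) (c u : ℝ) : ‖(X : ℂ) ^ (-(c + u * I : ℂ))‖ = X ^ (-c) := by
  rw [norm_cpow_eq_rpow_re_of_pos hX]
  simp

lemma continuous_cpow_neg_line (hX : 0 < X) (c : ℝ) :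
    Continuous fun u : ℝ => (X : ℂ) ^ (-(c + u * I : ℂ)) :=
  Continuous.const_cpow (by fun_prop) (.inl (ofReal_ne_zero.2 hX.ne'))

lemma integrable_kernel_mul_cpow_line (h : (block11 a b).AvoidsPoles c) (hX : 0 < X) :
    Integrable fun u : ℝ => (block11 a b).kernel (c + u * I) * (X : ℂ) ^ (-(c + u * I : ℂ)) :=
  (integrable_kernel_line h).mul_bdd (c := X ^ (-c))
    (continuous_cpow_neg_line hX c).aestronglyMeasurable
    (ae_of_all _ fun u => (norm_cpow_neg_line hX c u).le)

lemma mellinInv_block11_kernel_of_mem_strip (hb : -b < c) (ha : c < 1 - a) (hX : 0 < X) :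
    mellinInv c (block11 a b).kernel X = meijerG11 a b X := by
  have hmellin : ∀ u : ℝ, mellin (fun X => (meijerG11 a b X : ℂ)) (c + u * I)
      = (block11 a b).kernel (c + u * I) := fun u =>
    mellin_meijerG11 (by simpa using hb) (by simpa using ha)
  have hvert : VerticalIntegrable (mellin fun X => (meijerG11 a b X : ℂ)) c := by
    simp only [VerticalIntegrable, hmellin]
    exact integrable_kernel_line (block11_avoidsPoles_of_mem_strip hb ha)
  have hinv := mellinInv_mellin_eq c _ hX
    (mellinConvergent_meijerG11 (a := a) (b := b) (by simpa using hb) (by simpa using ha)) hvert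
    ((continuousOn_meijerG11 a b).continuousAt (Ioi_mem_nhds hX))
  rw [← hinv, mellinInv, mellinInv]
  simp only [hmellin]

lemma mellinInv_block11_kernel_reflect (a b c : ℝ) (hX : 0 < X) :
    mellinInv (-c) (block11 (1 - b) (1 - a)).kernel X⁻¹ = mellinInv c (block11 a b).kernel X := by
  rw [mellinInv_eq_mul_integral, mellinInv_eq_mul_integral, ← integral_neg_eq_self]
  congr 2 with u
  have hline : ((-c : ℝ) : ℂ) + ((-u : ℝ) : ℂ) * I = -(c + u * I) := by
    push_cast
    ring
  rw [hline, ← block11_kernel_neg, neg_neg, ← one_div, ofReal_div_cpow zero_le_one hX, ofReal_one,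
    one_cpow, one_mul]

lemma norm_mellinInv_le (c : ℝ) (φ : ℂ → ℂ) (hX : 0 < X) :
    ‖mellinInv c φ X‖ ≤ ‖(2 * Real.pi : ℂ)⁻¹‖ * (∫ u : ℝ, ‖φ (c + u * I)‖) * X ^ (-c) := by
  rw [mellinInv_eq_mul_integral, norm_mul, mul_assoc, ← integral_mul_const]
  gcongr
  refine (norm_integral_le_integral_norm _).trans_eq ?_
  simp only [norm_mul, norm_cpow_neg_line hX]

lemma rpow_le_add_rpow {x y z : ℝ} (p : ℝ) (hx : 0 < x) (hxy : x ≤ y) (hyz : y ≤ z) :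
    y ^ p ≤ x ^ p + z ^ p := by
  have hy : 0 < y := hx.trans_le hxy
  have hz : 0 < z := hy.trans_le hyz
  rcases le_total 0 p with hp | hp
  · exact (Real.rpow_le_rpow hy.le hyz hp).trans (le_add_of_nonneg_left (by positivity))
  · exact (Real.rpow_le_rpow_of_nonpos hx hxy hp).trans (le_add_of_nonneg_right (by positivity))

lemma hasDerivAt_ofReal_cpow_neg (hX : 0 < X) (z : ℂ) :
    HasDerivAt (fun x : ℝ => (x : ℂ) ^ (-z)) (-z * (X : ℂ) ^ (-(z + 1))) X := by
  have hcpow := (hasDerivAt_id (X : ℂ)).cpow_const (c := -z) (.inl (by simpa using hX))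
  rw [neg_add']
  simpa using hcpow.comp_ofReal

lemma rpow_neg_mul_cpow_neg (hX : 0 < X) (b : ℝ) (z : ℂ) :
    ((X ^ (-b) : ℝ) : ℂ) * (X : ℂ) ^ (-z) = (X : ℂ) ^ (-(b + z)) := by
  rw [ofReal_cpow hX.le, ← cpow_add _ _ (ofReal_ne_zero.2 hX.ne')]
  congr 1
  push_cast
  ring

lemma rpow_neg_mul_mellinInv (hX : 0 < X) (b c : ℝ) (φ : ℂ → ℂ) :
    ((X ^ (-b) : ℝ) : ℂ) * mellinInv c φ X = (2 * Real.pi : ℂ)⁻¹ *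
      ∫ u : ℝ, φ (c + u * I) * (X : ℂ) ^ (-(b + (c + u * I) : ℂ)) := by
  rw [mellinInv_eq_mul_integral, mul_left_comm, ← integral_const_mul]
  simp only [mul_left_comm _ (φ _), rpow_neg_mul_cpow_neg hX]

lemma integrable_kernel_mul_cpow_neg_add (h : (block11 a b).AvoidsPoles c) (hX : 0 < X) (b' : ℝ) :
    Integrable fun u : ℝ =>
      (block11 a b).kernel (c + u * I) * (X : ℂ) ^ (-(b' + (c + u * I) : ℂ)) := by
  refine ((integrable_kernel_mul_cpow_line h hX).const_mul ((X ^ (-b') : ℝ) : ℂ)).congr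
    (.of_forall fun u => ?_)
  simp only [mul_left_comm, rpow_neg_mul_cpow_neg hX]

lemma hasDerivAt_kernel_mul_cpow_neg_add (h : (block11 a b).AvoidsPoles c) (hX : 0 < X) (u : ℝ) :
    HasDerivAt
      (fun x : ℝ => (block11 a b).kernel (c + u * I) * (x : ℂ) ^ (-(b + (c + u * I) : ℂ)))
      (-((block11 a (b + 1)).kernel (c + u * I) *
        (X : ℂ) ^ (-((b + 1 : ℝ) + (c + u * I) : ℂ)))) X := by
  convert! (hasDerivAt_ofReal_cpow_neg hX (b + (c + u * I))).const_mul
    ((block11 a b).kernel (c + u * I)) using 1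
  rw [block11_kernel_raise_lower a b (h.add_ne_zero u)]
  push_cast
  rw [add_right_comm (b : ℂ)]
  ring

-- Differentiating `X ^ (-(b + s))` brings down the factor `b + s` that turns `Γ(b + s)` into
-- `Γ(b + 1 + s)`.
lemma hasDerivAt_rpow_neg_mul_mellinInv (h : (block11 a b).AvoidsPoles c) (hX : 0 < X) :
    HasDerivAt (fun x => ((x ^ (-b) : ℝ) : ℂ) * mellinInv c (block11 a b).kernel x)
      (-(((X ^ (-(b + 1)) : ℝ) : ℂ) * mellinInv c (block11 a (b + 1)).kernel X)) X := by
  obtain ⟨C, hC⟩ := exists_kernel_line_decay h.raise_lower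
  have hC0 : 0 ≤ C := by simpa using (norm_nonneg _).trans (hC 0)
  have hball : ∀ x ∈ Metric.ball X (X / 2), X / 2 ≤ x ∧ x ≤ X + X / 2 := by
    intro x hx
    rw [Metric.mem_ball, Real.dist_eq, abs_lt] at hx
    constructor <;> linarith
  have hpos : ∀ x ∈ Metric.ball X (X / 2), 0 < x := fun x hx =>
    (half_pos hX).trans_le (hball x hx).1
  set M : ℝ := (X / 2) ^ (-(b + 1 + c)) + (X + X / 2) ^ (-(b + 1 + c))
  have hbound : ∀ u : ℝ, ∀ x ∈ Metric.ball X (X / 2),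
      ‖-((block11 a (b + 1)).kernel (c + u * I) *
        (x : ℂ) ^ (-((b + 1 : ℝ) + (c + u * I) : ℂ)))‖ ≤ C * (1 + u ^ 2)⁻¹ * M := by
    intro u x hx
    have hnorm := norm_cpow_neg_line (hpos x hx) (b + 1 + c) u
    rw [ofReal_add _ c, add_assoc] at hnorm
    rw [norm_neg, norm_mul, hnorm]
    exact mul_le_mul (hC u) (rpow_le_add_rpow _ (half_pos hX) (hball x hx).1 (hball x hx).2)
      (Real.rpow_nonneg (hpos x hx).le _) (by positivity)
  have hint := (hasDerivAt_integral_of_dominated_loc_of_deriv_le (μ := volume)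
    (Metric.ball_mem_nhds X (half_pos hX))
    (eventually_of_mem (Metric.ball_mem_nhds X (half_pos hX)) fun x hx =>
      (integrable_kernel_mul_cpow_neg_add h (hpos x hx) b).aestronglyMeasurable)
    (integrable_kernel_mul_cpow_neg_add h hX b)
    (integrable_kernel_mul_cpow_neg_add h.raise_lower hX (b + 1)).neg.aestronglyMeasurable
    (ae_of_all _ hbound) ((integrable_inv_one_add_sq.const_mul C).mul_const M)
    (ae_of_all _ fun u x hx => hasDerivAt_kernel_mul_cpow_neg_add h (hpos x hx) u)).2.const_mul
      (2 * Real.pi : ℂ)⁻¹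
  rw [integral_neg, mul_neg] at hint
  rw [rpow_neg_mul_mellinInv hX]
  refine hint.congr_of_eventuallyEq ?_
  filter_upwards [Ioi_mem_nhds hX] with x hx using rpow_neg_mul_mellinInv hx b c _

lemma tendsto_rpow_neg_mul_mellinInv (φ : ℂ → ℂ) (hc : c < -b) :
    Tendsto (fun X => ((X ^ (-b) : ℝ) : ℂ) * mellinInv c φ X) (𝓝[>] 0) (𝓝 0) := by
  have hpow : Tendsto (fun X : ℝ => X ^ (-b - c)) (𝓝[>] 0) (𝓝 0) := by
    have hcont := (Real.continuousAt_rpow_const 0 (-b - c) (.inr (by linarith))).tendsto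
    rw [Real.zero_rpow (by linarith)] at hcont
    exact hcont.mono_left nhdsWithin_le_nhds
  set C := ‖(2 * Real.pi : ℂ)⁻¹‖ * ∫ u : ℝ, ‖φ (c + u * I)‖
  refine squeeze_zero_norm' ?_ (by simpa using hpow.const_mul C)
  filter_upwards [self_mem_nhdsWithin] with X (hX : 0 < X)
  rw [norm_mul, norm_real, Real.norm_of_nonneg (by positivity), sub_eq_add_neg, Real.rpow_add hX,
    mul_left_comm]
  gcongr
  exact norm_mellinInv_le c φ hX

end VerticalLine

section WrongPoles

/-- The residue of `(block11 a b).kernel` at its left pole `-b - k`. -/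
def leftResidue (a b : ℝ) (k : ℕ) : ℝ := (-1) ^ k / k.factorial * Real.Gamma (1 - a + b + k)

/-- The sum of the residues of `(block11 a b).kernel s * X ^ (-s)` at the left poles to the right of
the line `Re s = c`. By the reflection `s ↦ -s`, the corresponding sum for the right poles to the
left of that line is `leftResidueSum (1 - b) (1 - a) (-c) X⁻¹`, with the sign of the residues
changed. -/
def leftResidueSum (a b c X : ℝ) : ℝ :=
  ∑ k ∈ Finset.range ⌈-b - c⌉₊, leftResidue a b k * X ^ (b + k)

/-- The Meijer function `meijerG11 a b` without the contributions of the poles that are on the wrong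
side of the line `Re s = c`. -/
def meijerG11Remainder (a b c X : ℝ) : ℝ :=
  meijerG11 a b X - leftResidueSum a b c X - leftResidueSum (1 - b) (1 - a) (-c) X⁻¹

variable {a b c X : ℝ}

lemma leftResidue_succ_mul (a b : ℝ) (k : ℕ) :
    leftResidue a b (k + 1) * (k + 1) = -leftResidue a (b + 1) k := by
  have harg : 1 - a + b + ((k + 1 : ℕ) : ℝ) = 1 - a + (b + 1) + k := by
    push_cast
    ring
  rw [leftResidue, leftResidue, Nat.factorial_succ, pow_succ, harg]
  push_cast
  field_simp

lemma leftResidue_mul {k : ℕ} (h : 1 - a + b + k ≠ 0) :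
    leftResidue a b k * (1 - a + b + k) = leftResidue (a - 1) b k := by
  have harg : 1 - (a - 1) + b + k = 1 - a + b + k + 1 := by ring
  rw [leftResidue, leftResidue, harg, Real.Gamma_add_one h]
  ring

lemma meijerG11Remainder_reflect (a b c : ℝ) (hX : 0 < X) :
    meijerG11Remainder (1 - b) (1 - a) (-c) X⁻¹ = meijerG11Remainder a b c X := by
  rw [meijerG11Remainder, meijerG11Remainder, meijerG11_reflect a b hX, inv_inv, sub_sub_cancel,
    sub_sub_cancel, neg_neg]
  ring

lemma rpow_neg_mul_meijerG11Remainder (a b c : ℝ) (hX : 0 < X) :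
    X ^ (-b) * meijerG11Remainder a b c X =
      Real.Gamma (1 - a + b) * (1 + X) ^ (-(1 - a + b)) -
        (∑ k ∈ Finset.range ⌈-b - c⌉₊, leftResidue a b k * X ^ k) -
        ∑ k ∈ Finset.range ⌈c - (1 - a)⌉₊,
          leftResidue (1 - b) (1 - a) k * X ^ (-(1 - a + b + k)) := by
  have hone : X ^ (-b) * X ^ b = 1 := by rw [← Real.rpow_add hX, neg_add_cancel, Real.rpow_zero]
  have hleft : ∀ k : ℕ, X ^ (-b) * X ^ (b + k) = X ^ k := fun k => by
    rw [← Real.rpow_add hX, neg_add_cancel_left, Real.rpow_natCast]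
  have hright : ∀ k : ℕ, X ^ (-b) * X⁻¹ ^ (1 - a + k) = X ^ (-(1 - a + b + k)) := fun k => by
    rw [Real.inv_rpow hX.le, ← Real.rpow_neg hX.le, ← Real.rpow_add hX]
    congr 1
    ring
  have hcount : -(1 - a) - -c = c - (1 - a) := by ring
  simp only [meijerG11Remainder, leftResidueSum, mul_sub, Finset.mul_sum,
    mul_left_comm (X ^ (-b)), hleft, hright, hcount]
  rw [meijerG11]
  linear_combination Real.Gamma (1 - a + b) * (1 + X) ^ (-(1 - a + b)) * hone

lemma hasDerivAt_sum_leftResidue (a b : ℝ) (n : ℕ) (X : ℝ) :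
    HasDerivAt (fun x : ℝ => ∑ k ∈ Finset.range n, leftResidue a b k * x ^ k)
      (-∑ k ∈ Finset.range (n - 1), leftResidue a (b + 1) k * X ^ k) X := by
  convert! HasDerivAt.fun_sum fun k (_ : k ∈ Finset.range n) =>
    (hasDerivAt_pow k X).const_mul (leftResidue a b k) using 1
  rcases n with _ | n
  · simp
  rw [Finset.sum_range_succ', add_tsub_cancel_right]
  simp only [Nat.cast_zero, zero_mul, mul_zero, add_zero, add_tsub_cancel_right,
    ← Finset.sum_neg_distrib, ← neg_mul, ← leftResidue_succ_mul]
  exact Finset.sum_congr rfl fun k _ => by push_cast; ring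

lemma hasDerivAt_sum_rightResidue (hab : ∀ n : ℤ, b - a ≠ n) (n : ℕ) (hX : 0 < X) :
    HasDerivAt
      (fun x : ℝ => ∑ k ∈ Finset.range n,
        leftResidue (1 - b) (1 - a) k * x ^ (-(1 - a + b + k)))
      (-∑ k ∈ Finset.range n,
        leftResidue (1 - (b + 1)) (1 - a) k * X ^ (-(1 - a + (b + 1) + k))) X := by
  convert! HasDerivAt.fun_sum fun k (_ : k ∈ Finset.range n) =>
    (Real.hasDerivAt_rpow_const (p := -(1 - a + b + k)) (.inl hX.ne')).const_mul
      (leftResidue (1 - b) (1 - a) k) using 1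
  rw [← Finset.sum_neg_distrib]
  refine Finset.sum_congr rfl fun k _ => ?_
  have hk : 1 - (1 - b) + (1 - a) + k ≠ 0 := fun h0 => hab (-(k + 1)) (by push_cast; linarith)
  have hexp : -(1 - a + (b + 1) + k) = -(1 - a + b + k) - 1 := by ring
  rw [← sub_sub, ← leftResidue_mul hk, hexp]
  ring

lemma hasDerivAt_rpow_neg_mul_meijerG11Remainder (hab : ∀ n : ℤ, b - a ≠ n) (hX : 0 < X) :
    HasDerivAt (fun x => x ^ (-b) * meijerG11Remainder a b c x)
      (-(X ^ (-(b + 1)) * meijerG11Remainder a (b + 1) c X)) X := by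
  have hmain : HasDerivAt (fun x => Real.Gamma (1 - a + b) * (1 + x) ^ (-(1 - a + b)))
      (-(Real.Gamma (1 - a + (b + 1)) * (1 + X) ^ (-(1 - a + (b + 1))))) X := by
    have hab0 : 1 - a + b ≠ 0 := fun h0 => hab (-1) (by push_cast; linarith)
    have hexp : -(1 - a + b + 1) = -(1 - a + b) - 1 := by ring
    convert! (((hasDerivAt_id X).const_add 1).rpow_const (p := -(1 - a + b))
      (.inl (by simp only [id]; positivity))).const_mul (Real.Gamma (1 - a + b)) using 1
    rw [← add_assoc, Real.Gamma_add_one hab0, hexp]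
    simp only [id]
    ring
  have hcount : -(b + 1) - c = -b - c - 1 := by ring
  rw [rpow_neg_mul_meijerG11Remainder a (b + 1) c hX, hcount, Nat.ceil_sub_one]
  refine (((hmain.sub (hasDerivAt_sum_leftResidue a b ⌈-b - c⌉₊ X)).sub
    (hasDerivAt_sum_rightResidue hab ⌈c - (1 - a)⌉₊ hX)).congr_of_eventuallyEq ?_).congr_deriv ?_
  · filter_upwards [Ioi_mem_nhds hX] with x hx using rpow_neg_mul_meijerG11Remainder a b c hx
  · ring

lemma tendsto_rpow_neg_mul_meijerG11Remainder (hc : c < -b) :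
    Tendsto (fun X => X ^ (-b) * meijerG11Remainder a b c X) (𝓝[>] 0) (𝓝 0) := by
  have hright : ∀ k ∈ Finset.range ⌈c - (1 - a)⌉₊, 0 < -(1 - a + b + k) := by
    intro k hk
    have := Nat.lt_ceil.1 (Finset.mem_range.1 hk)
    linarith
  obtain ⟨n, hn⟩ := Nat.exists_eq_add_one.2 (Nat.ceil_pos.2 (show 0 < -b - c by linarith))
  set R : ℝ → ℝ := fun X => Real.Gamma (1 - a + b) * (1 + X) ^ (-(1 - a + b)) -
    (∑ k ∈ Finset.range (n + 1), leftResidue a b k * X ^ k) -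
    ∑ k ∈ Finset.range ⌈c - (1 - a)⌉₊, leftResidue (1 - b) (1 - a) k * X ^ (-(1 - a + b + k))
  have hcont : ContinuousAt R 0 := by
    refine ((continuousAt_const.mul ?_).sub (by fun_prop)).sub
      (tendsto_finsetSum _ fun k hk => (continuousAt_const.mul ?_).tendsto)
    · exact ContinuousAt.rpow_const (by fun_prop) (.inl (by simp))
    · exact Real.continuousAt_rpow_const _ _ (.inr (hright k hk).le)
  have hzero : R 0 = 0 := by
    simp only [R]
    rw [Finset.sum_range_succ', Finset.sum_eq_zero (s := Finset.range ⌈_⌉₊) fun k hk => by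
      rw [Real.zero_rpow (hright k hk).ne', mul_zero]]
    simp [leftResidue]
  have hlim := hcont.tendsto
  rw [hzero] at hlim
  refine (hlim.mono_left nhdsWithin_le_nhds).congr' ?_
  filter_upwards [self_mem_nhdsWithin] with X (hX : 0 < X)
  rw [rpow_neg_mul_meijerG11Remainder a b c hX, hn]

lemma eq_zero_of_hasDerivAt_zero_of_tendsto {E : Type*} [NormedAddCommGroup E] [NormedSpace ℝ E]
    {f : ℝ → E} (hf : ∀ x > 0, HasDerivAt f 0 x) (hlim : Tendsto f (𝓝[>] 0) (𝓝 0))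
    (hX : 0 < X) : f X = 0 := by
  refine tendsto_nhds_unique (tendsto_const_nhds.congr' ?_) hlim
  filter_upwards [self_mem_nhdsWithin] with Y hY
  exact isOpen_Ioi.is_const_of_deriv_eq_zero isPreconnected_Ioi
    (fun x hx => (hf x hx).differentiableAt.differentiableWithinAt)
    (fun x hx => (hf x hx).deriv) hX hY

lemma mellinInv_block11_kernel_eq_of_raise_lower (h : (block11 a b).AvoidsPoles c)
    (hab : ∀ n : ℤ, b - a ≠ n) (hc : c < -b)
    (hraise : ∀ x > 0, mellinInv c (block11 a (b + 1)).kernel x = meijerG11Remainder a (b + 1) c x)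
    (hX : 0 < X) : mellinInv c (block11 a b).kernel X = meijerG11Remainder a b c X := by
  set D : ℝ → ℂ := fun x => ((x ^ (-b) : ℝ) : ℂ) * mellinInv c (block11 a b).kernel x -
    ((x ^ (-b) * meijerG11Remainder a b c x : ℝ) : ℂ)
  have hderiv : ∀ x > 0, HasDerivAt D 0 x := by
    intro x hx
    convert! (hasDerivAt_rpow_neg_mul_mellinInv h hx).sub
      (hasDerivAt_rpow_neg_mul_meijerG11Remainder (c := c) hab hx).ofReal_comp using 1
    rw [hraise x hx]
    push_cast
    ring
  have hlim : Tendsto D (𝓝[>] 0) (𝓝 0) := by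
    simpa [D] using (tendsto_rpow_neg_mul_mellinInv (block11 a b).kernel hc).sub
      ((continuous_ofReal.tendsto 0).comp (tendsto_rpow_neg_mul_meijerG11Remainder (a := a) hc))
  have hD := eq_zero_of_hasDerivAt_zero_of_tendsto hderiv hlim hX
  simp only [D, ofReal_mul, ← mul_sub] at hD
  have hpow : ((X ^ (-b) : ℝ) : ℂ) ≠ 0 := ofReal_ne_zero.2 (by positivity)
  exact sub_eq_zero.1 ((mul_eq_zero.1 hD).resolve_left hpow)

-- Raising `b` past `-c` removes the left poles from the wrong side one at a time.
lemma mellinInv_block11_kernel_eq_of_forall_mem_left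
    (hleft : ∀ b X : ℝ, (block11 a b).AvoidsPoles c → (∀ n : ℤ, b - a ≠ n) → -b < c → 0 < X →
      mellinInv c (block11 a b).kernel X = meijerG11Remainder a b c X)
    (h : (block11 a b).AvoidsPoles c) (hab : ∀ n : ℤ, b - a ≠ n) (hX : 0 < X) :
    mellinInv c (block11 a b).kernel X = meijerG11Remainder a b c X := by
  induction hn : ⌈-b - c⌉₊ generalizing b X with
  | zero =>
    have hbc : b + c ≠ 0 := by simpa using (block11_avoidsPoles_iff.1 h).1 0
    have := Nat.ceil_eq_zero.1 hn
    exact hleft b X h hab (lt_of_le_of_ne (by linarith) fun hbc' => hbc (by linarith)) hX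
  | succ n ih =>
    have hc : 0 < -b - c := Nat.ceil_pos.1 (hn ▸ n.succ_pos)
    refine mellinInv_block11_kernel_eq_of_raise_lower h hab (by linarith) (fun x hx => ?_) hX
    refine ih h.raise_lower (fun m hm => hab (m - 1) (by push_cast; linarith)) hx ?_
    rw [neg_add, add_sub_right_comm, ← sub_eq_add_neg, Nat.ceil_sub_one, hn, add_tsub_cancel_right]

theorem mellinInv_block11_kernel_eq (h : (block11 a b).AvoidsPoles c) (hab : ∀ n : ℤ, b - a ≠ n)
    (hX : 0 < X) : mellinInv c (block11 a b).kernel X = meijerG11Remainder a b c X := by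
  refine mellinInv_block11_kernel_eq_of_forall_mem_left (fun b X h hab hbc hX => ?_) h hab hX
  rw [← mellinInv_block11_kernel_reflect a b c hX, ← meijerG11Remainder_reflect a b c hX]
  refine mellinInv_block11_kernel_eq_of_forall_mem_left (fun a' X _ _ hac hX => ?_) h.reflect
    (fun n hn => hab n (by linarith)) (inv_pos.2 hX)
  rw [mellinInv_block11_kernel_of_mem_strip hac (by linarith) hX, meijerG11Remainder,
    leftResidueSum, leftResidueSum, Nat.ceil_eq_zero.2 (by linarith),
    Nat.ceil_eq_zero.2 (by linarith)]
  simp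

end WrongPoles

section Parseval

variable {k : ℝ → ℂ} {φ : ℂ → ℂ} {s : ℂ} {d y : ℝ}

lemma cpow_neg_mul_cpow_add {w : ℝ} (hy : 0 < y) (hw : 0 < w) (s z : ℂ) :
    (y : ℂ) ^ (-z) * (w : ℂ) ^ (s + z - 1) = (w : ℂ) ^ (s - 1) * ((y / w : ℝ) : ℂ) ^ (-z) := by
  rw [ofReal_div_cpow hy.le hw, neg_neg, mul_left_comm, ← cpow_add _ _ (ofReal_ne_zero.2 hw.ne')]
  ring_nf

lemma integrable_prod_cpow_mul (hk : MellinConvergent k (s + d)) (hφ : VerticalIntegrable φ d)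
    (hy : 0 < y) :
    Integrable (Function.uncurry fun u w : ℝ => φ (d + u * I) * (y : ℂ) ^ (-(d + u * I : ℂ)) *
      ((w : ℂ) ^ (s + (d + u * I) - 1) * k w)) (volume.prod (volume.restrict (Ioi 0))) := by
  have hpos : ∀ᵐ p : ℝ × ℝ ∂volume.prod (volume.restrict (Ioi 0)), 0 < p.2 :=
    Measure.quasiMeasurePreserving_snd.ae (ae_restrict_mem measurableSet_Ioi)
  have hbdd := (hφ.mul_prod hk).mul_bdd (c := y ^ (-d))
    (g := fun p : ℝ × ℝ => (y : ℂ) ^ (-(d + p.1 * I : ℂ)) * (p.2 : ℂ) ^ (p.1 * I : ℂ))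
    (Measurable.aestronglyMeasurable (by fun_prop)) ?_
  · refine hbdd.congr ?_
    filter_upwards [hpos] with p hp
    have hexp : s + (d + p.1 * I) - 1 = (s + d - 1) + p.1 * I := by ring
    simp only [Function.uncurry, smul_eq_mul]
    rw [hexp, cpow_add _ _ (ofReal_ne_zero.2 hp.ne')]
    ring
  · filter_upwards [hpos] with p hp
    rw [norm_mul, norm_cpow_neg_line hy, norm_cpow_eq_rpow_re_of_pos hp]
    simp

lemma setIntegral_cpow_mul_eq_mellin (k : ℝ → ℂ) (φ : ℂ → ℂ) (s : ℂ) (d y u : ℝ) :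
    ∫ w in Ioi (0 : ℝ), φ (d + u * I) * (y : ℂ) ^ (-(d + u * I : ℂ)) *
        ((w : ℂ) ^ (s + (d + u * I) - 1) * k w) =
      mellin k (s + (d + u * I)) * φ (d + u * I) * (y : ℂ) ^ (-(d + u * I : ℂ)) := by
  simp only [integral_const_mul, mellin, smul_eq_mul]
  ring

lemma integral_cpow_mul_eq_mellinInv {w : ℝ} (k : ℝ → ℂ) (φ : ℂ → ℂ) (s : ℂ) (d : ℝ)
    (hy : 0 < y) (hw : 0 < w) :
    (2 * Real.pi : ℂ)⁻¹ * ∫ u : ℝ, φ (d + u * I) * (y : ℂ) ^ (-(d + u * I : ℂ)) *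
        ((w : ℂ) ^ (s + (d + u * I) - 1) * k w) =
      (w : ℂ) ^ (s - 1) • (k w * mellinInv d φ (y / w)) := by
  rw [mellinInv_eq_mul_integral, smul_eq_mul]
  simp only [← integral_const_mul]
  refine integral_congr_ae (.of_forall fun u => ?_)
  linear_combination (2 * Real.pi : ℂ)⁻¹ * φ (d + u * I) * k w *
    cpow_neg_mul_cpow_add hy hw s (d + u * I)

lemma integrable_mellin_mul_cpow (hk : MellinConvergent k (s + d)) (hφ : VerticalIntegrable φ d)
    (hy : 0 < y) :
    Integrable fun u : ℝ =>
      mellin k (s + (d + u * I)) * φ (d + u * I) * (y : ℂ) ^ (-(d + u * I : ℂ)) := by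
  simpa only [Function.uncurry, setIntegral_cpow_mul_eq_mellin] using
    (integrable_prod_cpow_mul hk hφ hy).integral_prod_left

lemma mellinConvergent_mul_mellinInv (hk : MellinConvergent k (s + d))
    (hφ : VerticalIntegrable φ d) (hy : 0 < y) :
    MellinConvergent (fun w => k w * mellinInv d φ (y / w)) s :=
  ((integrable_prod_cpow_mul hk hφ hy).integral_prod_right.const_mul (2 * Real.pi : ℂ)⁻¹).congr <|
    (ae_restrict_mem measurableSet_Ioi).mono fun _ hw =>
      integral_cpow_mul_eq_mellinInv k φ s d hy hw

lemma integral_mellin_mul_cpow_eq_mellin (hk : MellinConvergent k (s + d))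
    (hφ : VerticalIntegrable φ d) (hy : 0 < y) :
    (2 * Real.pi : ℂ)⁻¹ * ∫ u : ℝ,
        mellin k (s + (d + u * I)) * φ (d + u * I) * (y : ℂ) ^ (-(d + u * I : ℂ)) =
      mellin (fun w => k w * mellinInv d φ (y / w)) s := by
  simp only [← setIntegral_cpow_mul_eq_mellin]
  rw [integral_integral_swap (integrable_prod_cpow_mul hk hφ hy), ← integral_const_mul]
  exact setIntegral_congr_fun measurableSet_Ioi fun w hw =>
    integral_cpow_mul_eq_mellinInv k φ s d hy hw

end Parseval

section InnerIntegral

/-- The inverse Mellin transform, in `s`, of the inner integral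
`(2πi)⁻¹ ∫ Φ₁(s + t) Φ₃(t) y⁻ᵗ dt` for the blocks `Φ₁`, `Φ₃` of parameters `a₁, b₁` and
`a₃, b₃`. -/
def innerDensity (a₁ b₁ a₃ b₃ y w : ℝ) : ℝ := meijerG11 a₁ b₁ w * meijerG11 a₃ b₃ (y / w)

variable {a₁ b₁ a₃ b₃ d y : ℝ} {s : ℂ}

lemma isBigO_atTop_comp_div {f : ℝ → ℂ} {p : ℝ} (hf : f =O[𝓝[>] 0] (· ^ p)) (hy : 0 < y) :
    (fun w => f (y / w)) =O[atTop] (· ^ (-p)) := by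
  have hlim : Tendsto (fun w : ℝ => y / w) atTop (𝓝[>] 0) :=
    tendsto_nhdsWithin_iff.2 ⟨tendsto_const_nhds.div_atTop tendsto_id, by
      filter_upwards [eventually_gt_atTop 0] with w hw using div_pos hy hw⟩
  refine (hf.comp_tendsto hlim).trans
    ((Asymptotics.isBigO_const_mul_self (y ^ p) (fun w => w ^ (-p)) _).congr' ?_ .rfl)
  filter_upwards [eventually_gt_atTop 0] with w hw
  rw [Function.comp_apply, Real.div_rpow hy.le hw.le, Real.rpow_neg hw.le, div_eq_mul_inv]

lemma isBigO_zero_comp_div {f : ℝ → ℂ} {p : ℝ} (hf : f =O[atTop] (· ^ p)) (hy : 0 < y) :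
    (fun w => f (y / w)) =O[𝓝[>] 0] (· ^ (-p)) := by
  have hlim : Tendsto (fun w : ℝ => y / w) (𝓝[>] 0) atTop := by
    simpa only [div_eq_mul_inv] using tendsto_inv_nhdsGT_zero.const_mul_atTop hy
  refine (hf.comp_tendsto hlim).trans
    ((Asymptotics.isBigO_const_mul_self (y ^ p) (fun w => w ^ (-p)) _).congr' ?_ .rfl)
  filter_upwards [self_mem_nhdsWithin] with w (hw : 0 < w)
  rw [Function.comp_apply, Real.div_rpow hy.le hw.le, Real.rpow_neg hw.le, div_eq_mul_inv]

lemma locallyIntegrableOn_innerDensity (a₁ b₁ a₃ b₃ : ℝ) (hy : 0 < y) :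
    LocallyIntegrableOn (fun w => (innerDensity a₁ b₁ a₃ b₃ y w : ℂ)) (Ioi 0) := by
  refine ContinuousOn.locallyIntegrableOn ?_ measurableSet_Ioi
  simp only [innerDensity, ofReal_mul]
  exact (continuousOn_meijerG11 a₁ b₁).mul <| (continuousOn_meijerG11 a₃ b₃).comp
    (continuousOn_const.div continuousOn_id fun w hw => ne_of_gt hw) fun w hw => div_pos hy hw

lemma innerDensity_isBigO_atTop (h₁ : a₁ < 1 + b₁) (h₃ : a₃ < 1 + b₃) (hy : 0 < y) :
    (fun w => (innerDensity a₁ b₁ a₃ b₃ y w : ℂ)) =O[atTop] (· ^ (-(1 - a₁ + b₃))) := by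
  simp only [innerDensity, ofReal_mul]
  refine ((meijerG11_isBigO_atTop h₁).mul
    (isBigO_atTop_comp_div (meijerG11_isBigO_zero h₃) hy)).congr' .rfl ?_
  filter_upwards [eventually_gt_atTop 0] with w hw
  rw [← Real.rpow_add hw]
  ring_nf

lemma innerDensity_isBigO_zero (h₁ : a₁ < 1 + b₁) (h₃ : a₃ < 1 + b₃) (hy : 0 < y) :
    (fun w => (innerDensity a₁ b₁ a₃ b₃ y w : ℂ)) =O[𝓝[>] 0] (· ^ (-(a₃ - b₁ - 1))) := by
  simp only [innerDensity, ofReal_mul]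
  refine ((meijerG11_isBigO_zero h₁).mul
    (isBigO_zero_comp_div (meijerG11_isBigO_atTop h₃) hy)).congr' .rfl ?_
  filter_upwards [self_mem_nhdsWithin] with w (hw : 0 < w)
  rw [← Real.rpow_add hw]
  ring_nf

lemma mellinConvergent_innerDensity (h₁ : a₁ < 1 + b₁) (h₃ : a₃ < 1 + b₃) (hy : 0 < y)
    (hl : a₃ - b₁ - 1 < s.re) (hr : s.re < 1 - a₁ + b₃) :
    MellinConvergent (fun w => (innerDensity a₁ b₁ a₃ b₃ y w : ℂ)) s :=
  mellinConvergent_of_isBigO_rpow (locallyIntegrableOn_innerDensity a₁ b₁ a₃ b₃ hy)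
    (innerDensity_isBigO_atTop h₁ h₃ hy) hr (innerDensity_isBigO_zero h₁ h₃ hy) hl

lemma differentiableAt_mellin_innerDensity (h₁ : a₁ < 1 + b₁) (h₃ : a₃ < 1 + b₃) (hy : 0 < y)
    (hl : a₃ - b₁ - 1 < s.re) (hr : s.re < 1 - a₁ + b₃) :
    DifferentiableAt ℂ (mellin fun w => (innerDensity a₁ b₁ a₃ b₃ y w : ℂ)) s :=
  mellin_differentiableAt_of_isBigO_rpow (locallyIntegrableOn_innerDensity a₁ b₁ a₃ b₃ hy)
    (innerDensity_isBigO_atTop h₁ h₃ hy) hr (innerDensity_isBigO_zero h₁ h₃ hy) hl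

lemma block11_kernel_add_eq_mellin (hl : -b₁ < s.re + d) (hr : s.re + d < 1 - a₁) (u : ℝ) :
    (block11 a₁ b₁).kernel (s + (d + u * I)) =
      mellin (fun w => (meijerG11 a₁ b₁ w : ℂ)) (s + (d + u * I)) :=
  (mellin_meijerG11 (by simpa using hl) (by simpa using hr)).symm

lemma integrable_innerIntegrand (hy : 0 < y) (hl₃ : -b₃ < d) (hr₃ : d < 1 - a₃)
    (hl₁ : -b₁ < s.re + d) (hr₁ : s.re + d < 1 - a₁) :
    Integrable fun u : ℝ => (block11 a₁ b₁).kernel (s + (d + u * I)) *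
      (block11 a₃ b₃).kernel (d + u * I) * (y : ℂ) ^ (-(d + u * I : ℂ)) := by
  simp only [block11_kernel_add_eq_mellin hl₁ hr₁]
  exact integrable_mellin_mul_cpow
    (mellinConvergent_meijerG11 (by simpa using hl₁) (by simpa using hr₁))
    (integrable_kernel_line (block11_avoidsPoles_of_mem_strip hl₃ hr₃)) hy

lemma integral_innerIntegrand_eq_mellin (hy : 0 < y) (hl₃ : -b₃ < d) (hr₃ : d < 1 - a₃)
    (hl₁ : -b₁ < s.re + d) (hr₁ : s.re + d < 1 - a₁) :
    (2 * Real.pi : ℂ)⁻¹ * ∫ u : ℝ, (block11 a₁ b₁).kernel (s + (d + u * I)) *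
        (block11 a₃ b₃).kernel (d + u * I) * (y : ℂ) ^ (-(d + u * I : ℂ)) =
      mellin (fun w => (innerDensity a₁ b₁ a₃ b₃ y w : ℂ)) s := by
  simp only [block11_kernel_add_eq_mellin hl₁ hr₁]
  rw [integral_mellin_mul_cpow_eq_mellin
    (mellinConvergent_meijerG11 (by simpa using hl₁) (by simpa using hr₁))
    (integrable_kernel_line (block11_avoidsPoles_of_mem_strip hl₃ hr₃)) hy]
  refine setIntegral_congr_fun measurableSet_Ioi fun w (hw : 0 < w) => ?_
  simp only [mellinInv_block11_kernel_of_mem_strip hl₃ hr₃ (div_pos hy hw), innerDensity,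
    ofReal_mul]

end InnerIntegral

section Residues

variable {a b r : ℝ} {h : ℂ → ℂ}

lemma neg_mem_block11_leftPoles {p : ℂ} :
    -p ∈ (block11 (1 - b) (1 - a)).leftPoles ↔ p ∈ (block11 a b).rightPoles := by
  simp only [mem_block11_leftPoles, mem_block11_rightPoles]
  refine exists_congr fun k => ?_
  push_cast
  constructor <;> intro hp <;> linear_combination -hp

lemma neg_mem_block11_rightPoles {p : ℂ} :
    -p ∈ (block11 (1 - b) (1 - a)).rightPoles ↔ p ∈ (block11 a b).leftPoles := by
  simp only [mem_block11_leftPoles, mem_block11_rightPoles]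
  refine exists_congr fun k => ?_
  push_cast
  constructor <;> intro hp <;> linear_combination -hp

lemma disjoint_block11_poles (hab : ∀ n : ℤ, b - a ≠ n) :
    Disjoint (block11 a b).leftPoles (block11 a b).rightPoles := by
  refine Set.disjoint_left.2 fun p hl hr => ?_
  obtain ⟨i, rfl⟩ := mem_block11_leftPoles.1 hl
  obtain ⟨k, hk⟩ := mem_block11_rightPoles.1 hr
  refine hab (-1 - i - k) ?_
  have hre := congrArg re hk
  simp only [sub_re, neg_re, add_re, one_re, ofReal_re, natCast_re] at hre
  push_cast
  linarith

lemma circleMap_neg_add_pi (p : ℂ) (r θ : ℝ) :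
    circleMap (-p) r (θ + Real.pi) = -circleMap p r θ := by
  simp only [circleMap, ofReal_add, add_mul, exp_add, exp_pi_mul_I]
  ring

lemma circleIntegral_comp_neg (f : ℂ → ℂ) (p : ℂ) (r : ℝ) :
    ∮ z in C(p, r), f (-z) = -∮ z in C(-p, r), f z := by
  set g : ℝ → ℂ := fun θ => deriv (circleMap (-p) r) θ • f (circleMap (-p) r θ)
  have hper : Function.Periodic g (2 * Real.pi) := fun θ => by
    simp only [g, deriv_circleMap, periodic_circleMap _ r θ]
  have hshift (θ : ℝ) : deriv (circleMap p r) θ • f (-circleMap p r θ) = -g (θ + Real.pi) := by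
    have hzero := circleMap_neg_add_pi 0 r θ
    rw [neg_zero] at hzero
    simp only [g, deriv_circleMap, circleMap_neg_add_pi, hzero, neg_mul, neg_smul, neg_neg]
  calc ∮ z in C(p, r), f (-z)
      = -∫ θ in 0..2 * Real.pi, g (θ + Real.pi) := by
        rw [circleIntegral, ← intervalIntegral.integral_neg]
        exact intervalIntegral.integral_congr fun θ _ => hshift θ
    _ = -∫ θ in Real.pi..Real.pi + 2 * Real.pi, g θ := by
        rw [intervalIntegral.integral_comp_add_right, zero_add, add_comm (2 * Real.pi)]
    _ = -∮ z in C(-p, r), f z := by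
        rw [hper.intervalIntegral_add_eq Real.pi 0, zero_add, circleIntegral]

lemma block11_poles_raise_lower_subset :
    (block11 a (b + 1)).leftPoles ∪ (block11 a (b + 1)).rightPoles ⊆
      (block11 a b).leftPoles ∪ (block11 a b).rightPoles := by
  refine union_subset_union (fun q hq => ?_) fun q hq =>
    mem_block11_rightPoles.2 (mem_block11_rightPoles.1 hq)
  obtain ⟨k, rfl⟩ := mem_block11_leftPoles.1 hq
  refine mem_block11_leftPoles.2 ⟨k + 1, ?_⟩
  push_cast
  ring

lemma neg_notMem_block11_poles_raise_lower (hab : ∀ n : ℤ, b - a ≠ n) :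
    (-b : ℂ) ∉ (block11 a (b + 1)).leftPoles ∪ (block11 a (b + 1)).rightPoles := by
  simp only [mem_union, mem_block11_leftPoles, mem_block11_rightPoles]
  rintro (⟨k, hk⟩ | ⟨k, hk⟩) <;> replace hk := congrArg re hk
  · simp only [neg_re, sub_re, ofReal_re, natCast_re] at hk
    have := k.cast_nonneg (α := ℝ)
    linarith
  · simp only [neg_re, sub_re, add_re, one_re, ofReal_re, natCast_re] at hk
    refine hab (-1 - k) ?_
    push_cast
    linarith

lemma circleIntegral_block11_kernel_zero (hab : ∀ n : ℤ, b - a ≠ n) (hr : 0 < r)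
    (hh : DifferentiableOn ℂ h (Metric.closedBall (-b) r))
    (hiso : ∀ q ∈ (block11 a b).leftPoles ∪ (block11 a b).rightPoles,
      q ∈ Metric.closedBall (-b : ℂ) r → q = -b) :
    (2 * Real.pi * I)⁻¹ * ∮ z in C(-b, r), (block11 a b).kernel z * h z =
      leftResidue a b 0 * h (-b) := by
  have hd : DifferentiableOn ℂ (fun z => (block11 a (b + 1)).kernel z * h z)
      (Metric.closedBall (-b : ℂ) r) := by
    refine DifferentiableOn.mul (fun z hz => DifferentiableAt.differentiableWithinAt ?_) hh
    refine differentiableAt_block11_kernel fun hq => ?_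
    rw [hiso z (block11_poles_raise_lower_subset hq) hz] at hq
    exact neg_notMem_block11_poles_raise_lower hab hq
  have hcauchy := hd.circleIntegral_sub_inv_smul (Metric.mem_ball_self hr)
  have hval : (block11 a (b + 1)).kernel (-b) = leftResidue a b 0 := by
    rw [block11_kernel, leftResidue]
    simp [← Gamma_ofReal]
  have hcongr : ∮ z in C(-b, r), (block11 a b).kernel z * h z =
      ∮ z in C(-b, r), (z - -b)⁻¹ • ((block11 a (b + 1)).kernel z * h z) := by
    refine circleIntegral.integral_congr hr.le fun z hz => ?_
    have hbz : (b : ℂ) + z ≠ 0 := fun h0 => by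
      rw [eq_neg_of_add_eq_zero_right h0, Metric.mem_sphere, dist_self] at hz
      exact hr.ne hz
    rw [block11_kernel_raise_lower a b hbz, sub_neg_eq_add, smul_eq_mul, add_comm z]
    field_simp
  rw [hcongr, hcauchy, hval, smul_eq_mul, inv_mul_cancel_left₀ two_pi_I_ne_zero]

lemma circleIntegral_block11_kernel_left (k : ℕ) (hab : ∀ n : ℤ, b - a ≠ n) (hr : 0 < r)
    (hh : DifferentiableOn ℂ h (Metric.closedBall (-b - k) r))
    (hiso : ∀ q ∈ (block11 a b).leftPoles ∪ (block11 a b).rightPoles,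
      q ∈ Metric.closedBall (-b - k : ℂ) r → q = -b - k) :
    (2 * Real.pi * I)⁻¹ * ∮ z in C(-b - k, r), (block11 a b).kernel z * h z =
      leftResidue a b k * h (-b - k) := by
  induction k generalizing b h with
  | zero =>
    simp only [Nat.cast_zero, sub_zero] at hh hiso ⊢
    exact circleIntegral_block11_kernel_zero hab hr hh hiso
  | succ k ih =>
    have hcenter : (-b - (k + 1 : ℕ) : ℂ) = -(b + 1 : ℝ) - k := by
      push_cast
      ring
    rw [hcenter] at hh hiso ⊢
    have hne : ∀ z ∈ Metric.closedBall (-(b + 1 : ℝ) - k : ℂ) r, (b : ℂ) + z ≠ 0 := by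
      intro z hz h0
      have hz0 := eq_neg_of_add_eq_zero_right h0
      have hre := congrArg re (hiso z (.inl (mem_block11_leftPoles.2 ⟨0, by simp [hz0]⟩)) hz)
      simp only [hz0, neg_re, sub_re, ofReal_re, natCast_re] at hre
      have := k.cast_nonneg (α := ℝ)
      linarith
    have hkernel : ∮ z in C(-(b + 1 : ℝ) - k, r), (block11 a b).kernel z * h z =
        ∮ z in C(-(b + 1 : ℝ) - k, r), (block11 a (b + 1)).kernel z * (h z / (b + z)) := by
      refine circleIntegral.integral_congr hr.le fun z hz => ?_
      have hbz := hne z (Metric.sphere_subset_closedBall hz)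
      rw [block11_kernel_raise_lower a b hbz]
      field_simp
    rw [hkernel, ih (fun n hn => hab (n - 1) (by push_cast; linarith))
      (h := fun z => h z / (b + z)) (hh.div (by fun_prop) hne)
      fun q hq => hiso q (block11_poles_raise_lower_subset hq)]
    have hres : (leftResidue a b (k + 1) * (k + 1) : ℂ) = -leftResidue a (b + 1) k := by
      exact_mod_cast leftResidue_succ_mul a b k
    have hden : (b + (-(b + 1 : ℝ) - k) : ℂ) = -(k + 1) := by
      push_cast
      ring
    rw [hden, div_neg, mul_neg, ← neg_mul, ← hres]
    field_simp

lemma circleIntegral_block11_kernel_right (k : ℕ) (hab : ∀ n : ℤ, b - a ≠ n) (hr : 0 < r)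
    (hh : DifferentiableOn ℂ h (Metric.closedBall (1 - a + k) r))
    (hiso : ∀ q ∈ (block11 a b).leftPoles ∪ (block11 a b).rightPoles,
      q ∈ Metric.closedBall (1 - a + k : ℂ) r → q = 1 - a + k) :
    (2 * Real.pi * I)⁻¹ * ∮ z in C(1 - a + k, r), (block11 a b).kernel z * h z =
      -(leftResidue (1 - b) (1 - a) k * h (1 - a + k)) := by
  have hcenter : (-(1 - a : ℝ) - k : ℂ) = -(1 - a + k) := by
    push_cast
    ring
  have hreflect : ∮ z in C(1 - a + k, r), (block11 a b).kernel z * h z =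
      -∮ z in C(-(1 - a : ℝ) - k, r), (block11 (1 - b) (1 - a)).kernel z * h (-z) := by
    rw [hcenter, ← circleIntegral_comp_neg]
    simp only [← block11_kernel_neg, neg_neg]
  have hneg : MapsTo Neg.neg (Metric.closedBall (-(1 - a : ℝ) - k : ℂ) r)
      (Metric.closedBall (1 - a + k) r) := fun z hz => by
    rwa [hcenter, Metric.mem_closedBall, ← dist_neg_neg, neg_neg] at hz
  rw [hreflect, mul_neg, circleIntegral_block11_kernel_left (a := 1 - b) (h := fun z => h (-z)) k
    (fun n hn => hab n (by linarith)) hr, hcenter, neg_neg]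
  · exact hh.comp (by fun_prop) hneg
  · intro q hq hqr
    have hq' : -q ∈ (block11 a b).leftPoles ∪ (block11 a b).rightPoles := by
      rw [← neg_neg q, mem_union, neg_mem_block11_leftPoles, neg_mem_block11_rightPoles] at hq
      exact hq.symm
    rw [hcenter, ← hiso (-q) hq' (hneg hqr), neg_neg]

end Residues

section ContourExistence

variable {a b c l u : ℝ} {p q : ℂ}

lemma re_le_of_mem_block11_leftPoles (hp : p ∈ (block11 a b).leftPoles) : p.re ≤ -b := by
  obtain ⟨k, rfl⟩ := mem_block11_leftPoles.1 hp
  simp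

lemma le_re_of_mem_block11_rightPoles (hp : p ∈ (block11 a b).rightPoles) : 1 - a ≤ p.re := by
  obtain ⟨k, rfl⟩ := mem_block11_rightPoles.1 hp
  simp

lemma exists_pos_forall_le_abs_sub_intCast {t : ℝ} (ht : ∀ n : ℤ, t ≠ n) :
    ∃ δ > 0, ∀ n : ℤ, δ ≤ |t - n| :=
  ⟨|t - round t|, abs_pos.2 (sub_ne_zero.2 (ht _)), round_le t⟩

lemma exists_mem_Ioo_forall_add_ne_intCast (a b : ℝ) (h : l < u) :
    ∃ c ∈ Ioo l u, (∀ n : ℤ, a + c ≠ n) ∧ ∀ n : ℤ, b + c ≠ n := by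
  have hcount : (range (fun n : ℤ => n - a) ∪ range fun n : ℤ => n - b).Countable :=
    (countable_range _).union (countable_range _)
  obtain ⟨c, hc, hcn⟩ := (hcount.dense_compl ℝ).exists_mem_open isOpen_Ioo (nonempty_Ioo.2 h)
  simp only [mem_compl_iff, mem_union, mem_range, not_or, not_exists] at hc
  exact ⟨c, hcn, fun n hn => hc.1 n (by linarith), fun n hn => hc.2 n (by linarith)⟩

lemma exists_pole_line_separation (hac : ∀ n : ℤ, a + c ≠ n) (hbc : ∀ n : ℤ, b + c ≠ n) :
    ∃ δ > 0, ∀ p ∈ (block11 a b).leftPoles ∪ (block11 a b).rightPoles, δ ≤ |p.re - c| := by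
  obtain ⟨δa, ha, hδa⟩ := exists_pos_forall_le_abs_sub_intCast hac
  obtain ⟨δb, hb, hδb⟩ := exists_pos_forall_le_abs_sub_intCast hbc
  refine ⟨min δa δb, lt_min ha hb, ?_⟩
  rintro p (hp | hp)
  · obtain ⟨k, rfl⟩ := mem_block11_leftPoles.1 hp
    refine (min_le_right _ _).trans ((hδb (-k)).trans_eq ?_)
    rw [← abs_neg]
    simp only [sub_re, neg_re, ofReal_re, natCast_re]
    push_cast
    ring_nf
  · obtain ⟨k, rfl⟩ := mem_block11_rightPoles.1 hp
    refine (min_le_left _ _).trans ((hδa (1 + k)).trans_eq ?_)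
    rw [← abs_neg]
    simp only [sub_re, add_re, one_re, ofReal_re, natCast_re]
    push_cast
    ring_nf

lemma exists_pole_separation (hab : ∀ n : ℤ, b - a ≠ n) :
    ∃ δ > 0, ∀ p ∈ (block11 a b).leftPoles ∪ (block11 a b).rightPoles,
      ∀ q ∈ (block11 a b).leftPoles ∪ (block11 a b).rightPoles, q ≠ p → δ ≤ dist q p := by
  obtain ⟨δ, hδ0, hδ⟩ := exists_pos_forall_le_abs_sub_intCast hab
  have hdiff : ∀ n : ℤ, n ≠ 0 → min 1 δ ≤ ‖(n : ℂ)‖ := fun n hn => by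
    rw [norm_intCast]
    exact (min_le_left _ _).trans (mod_cast Int.one_le_abs hn)
  have hmixed (n : ℤ) : min 1 δ ≤ ‖((b - a - n : ℝ) : ℂ)‖ := by
    rw [norm_real]
    exact (min_le_right _ _).trans (hδ n)
  refine ⟨min 1 δ, lt_min one_pos hδ0, ?_⟩
  simp only [mem_union, mem_block11_leftPoles, mem_block11_rightPoles, dist_eq_norm]
  rintro p (⟨i, rfl⟩ | ⟨i, rfl⟩) q (⟨k, rfl⟩ | ⟨k, rfl⟩) hqp
  · rw [show (-b - k - (-b - i) : ℂ) = ((i - k : ℤ) : ℂ) by push_cast; ring]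
    refine hdiff _ fun h => hqp ?_
    rw [Nat.cast_inj.1 (sub_eq_zero.1 h)]
  · rw [show (1 - a + k - (-b - i) : ℂ) = ((b - a - ((-1 - i - k : ℤ) : ℝ) : ℝ) : ℂ) by
      push_cast; ring]
    exact hmixed _
  · rw [norm_sub_rev,
      show (1 - a + i - (-b - k) : ℂ) = ((b - a - ((-1 - i - k : ℤ) : ℝ) : ℝ) : ℂ) by
      push_cast; ring]
    exact hmixed _
  · rw [show (1 - a + k - (1 - a + i) : ℂ) = ((k - i : ℤ) : ℂ) by push_cast; ring]
    refine hdiff _ fun h => hqp ?_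
    rw [Nat.cast_inj.1 (sub_eq_zero.1 h)]

variable {a₁ b₁ a₂ b₂ a₃ b₃ r : ℝ} {s : ℂ}

/-- The abscissa of the `t`-contour at `s`: the middle of the strip between the left and the right
poles of `t ↦ Φ₁(s + t) Φ₃(t)`, for the blocks `Φ₁`, `Φ₃` of parameters `a₁, b₁` and `a₃, b₃`. -/
def middleAbscissa (a₁ b₁ a₃ b₃ : ℝ) (s : ℂ) : ℝ :=
  (max (-b₃) (-b₁ - s.re) + min (1 - a₃) (1 - a₁ - s.re)) / 2

lemma middleAbscissa_mem_strip (h₁ : a₁ < 1 + b₁) (h₃ : a₃ < 1 + b₃) (hl : a₃ - b₁ - 1 < s.re)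
    (hr : s.re < 1 - a₁ + b₃) :
    middleAbscissa a₁ b₁ a₃ b₃ s ∈ Ioo (max (-b₃) (-b₁ - s.re)) (min (1 - a₃) (1 - a₁ - s.re)) := by
  have hlt : max (-b₃) (-b₁ - s.re) < min (1 - a₃) (1 - a₁ - s.re) := by
    rw [max_lt_iff, lt_min_iff, lt_min_iff]
    exact ⟨⟨by linarith, by linarith⟩, by linarith, by linarith⟩
  rw [middleAbscissa]
  constructor <;> linarith

lemma admissible_of_support_subset_strip (h₁ : a₁ < 1 + b₁) (h₃ : a₃ < 1 + b₃)
    (hab : ∀ n : ℤ, b₂ - a₂ ≠ n) (hr : 0 < r)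
    (hline : ∀ p ∈ (block11 a₂ b₂).leftPoles ∪ (block11 a₂ b₂).rightPoles, r < |p.re - c|)
    (hsep : ∀ p ∈ (block11 a₂ b₂).leftPoles ∪ (block11 a₂ b₂).rightPoles,
      ∀ q ∈ (block11 a₂ b₂).leftPoles ∪ (block11 a₂ b₂).rightPoles, q ≠ p → r < dist q p)
    (hsupp : ∀ s ∈ BarnesContour.support ⟨c, r, middleAbscissa a₁ b₁ a₃ b₃⟩ (block11 a₂ b₂),
      s.re ∈ Ioo (a₃ - b₁ - 1) (1 - a₁ + b₃)) :
    BarnesContour.Admissible ⟨c, r, middleAbscissa a₁ b₁ a₃ b₃⟩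
      (block11 a₁ b₁) (block11 a₂ b₂) (block11 a₃ b₃) := by
  have hwrong : ∀ p ∈ BarnesContour.wrongLeft ⟨c, r, middleAbscissa a₁ b₁ a₃ b₃⟩ (block11 a₂ b₂) ∪
      BarnesContour.wrongRight ⟨c, r, middleAbscissa a₁ b₁ a₃ b₃⟩ (block11 a₂ b₂),
      p ∈ (block11 a₂ b₂).leftPoles ∪ (block11 a₂ b₂).rightPoles :=
    fun p hp => hp.imp And.left And.left
  have hd : ∀ s ∈ BarnesContour.support ⟨c, r, middleAbscissa a₁ b₁ a₃ b₃⟩ (block11 a₂ b₂),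
      max (-b₃) (-b₁ - s.re) < middleAbscissa a₁ b₁ a₃ b₃ s ∧
        middleAbscissa a₁ b₁ a₃ b₃ s < min (1 - a₃) (1 - a₁ - s.re) := fun s hs =>
    middleAbscissa_mem_strip h₁ h₃ (hsupp s hs).1 (hsupp s hs).2
  simp only [max_lt_iff, lt_min_iff] at hd
  refine ⟨hr, disjoint_block11_poles hab, fun p hp hpc => ?_, fun p hp => hline p (hwrong p hp),
    fun p hp => hsep p (hwrong p hp), fun s hs p hp => ?_, fun s hs p hp => ?_,
    fun s hs p hp => ?_, fun s hs p hp => ?_⟩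
  · have := hline p hp
    rw [hpc, sub_self, abs_zero] at this
    exact this.not_gt hr
  · exact (re_le_of_mem_block11_leftPoles hp).trans_lt (hd s hs).1.1
  · exact (hd s hs).2.1.trans_le (le_re_of_mem_block11_rightPoles hp)
  · linarith [re_le_of_mem_block11_leftPoles hp, (hd s hs).1.2]
  · linarith [le_re_of_mem_block11_rightPoles hp, (hd s hs).2.2]

lemma re_mem_Ioo_of_mem_support {d : ℂ → ℝ} (hc : c ∈ Ioo (l + r) (u - r)) (hr : 0 < r)
    (hb : -b + r < u) (ha : l < 1 - a - r)
    (hs : s ∈ BarnesContour.support ⟨c, r, d⟩ (block11 a b)) : s.re ∈ Ioo l u := by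
  obtain ⟨hcl, hcu⟩ := hc
  rcases hs with (hsc : s.re = c) | ⟨p, hp, hsp⟩
  · rw [hsc]
    exact ⟨by linarith, by linarith⟩
  · have hre : |(s - p).re| ≤ r := (abs_re_le_norm _).trans (by rw [← dist_eq]; exact hsp.le)
    rw [sub_re, abs_le] at hre
    rcases hp with ⟨hp, hpc⟩ | ⟨hp, hpc⟩
    · exact ⟨by linarith only [hre.1, hcl, show c < p.re from hpc],
        by linarith [re_le_of_mem_block11_leftPoles hp]⟩
    · exact ⟨by linarith [le_re_of_mem_block11_rightPoles hp],
        by linarith only [hre.2, hcu, show p.re < c from hpc]⟩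

theorem exists_admissible (h₁ : a₁ < 1 + b₁) (h₃ : a₃ < 1 + b₃) (hab : ∀ n : ℤ, b₂ - a₂ ≠ n)
    (hb : -b₂ < 1 - a₁ + b₃) (ha : a₃ - b₁ - 1 < 1 - a₂) :
    ∃ C : BarnesContour, C.Admissible (block11 a₁ b₁) (block11 a₂ b₂) (block11 a₃ b₃) := by
  obtain ⟨c, hc, hac, hbc⟩ := exists_mem_Ioo_forall_add_ne_intCast a₂ b₂
    (show a₃ - b₁ - 1 < 1 - a₁ + b₃ by linarith)
  obtain ⟨δ, hδ0, hδ⟩ := exists_pole_line_separation hac hbc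
  obtain ⟨ε, hε0, hε⟩ := exists_pole_separation hab
  have hsmall : ∀ᶠ r in 𝓝[>] (0 : ℝ), 0 < r ∧ r < δ ∧ r < ε ∧ r < c - (a₃ - b₁ - 1) ∧
      r < 1 - a₁ + b₃ - c ∧ r < 1 - a₁ + b₃ + b₂ ∧ r < 1 - a₂ - (a₃ - b₁ - 1) := by
    have hlt {t : ℝ} (ht : 0 < t) : ∀ᶠ r in 𝓝[>] (0 : ℝ), r < t :=
      nhdsWithin_le_nhds (gt_mem_nhds ht)
    filter_upwards [self_mem_nhdsWithin, hlt hδ0, hlt hε0, hlt (sub_pos.2 hc.1),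
      hlt (sub_pos.2 hc.2), hlt (neg_lt_iff_pos_add.1 hb), hlt (sub_pos.2 ha)] with r
      using fun h0 h1 h2 h3 h4 h5 h6 => ⟨h0, h1, h2, h3, h4, h5, h6⟩
  obtain ⟨r, hr, hrδ, hrε, hrl, hru, hrb, hra⟩ := hsmall.exists
  exact ⟨_, admissible_of_support_subset_strip h₁ h₃ hab hr (fun p hp => hrδ.trans_le (hδ p hp))
    (fun p hp q hq hqp => hrε.trans_le (hε p hp q hq hqp)) fun s hs =>
      re_mem_Ioo_of_mem_support ⟨by linarith, by linarith⟩ hr (by linarith) (by linarith) hs⟩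

end ContourExistence

section MellinSum

variable {k : ℝ → ℂ} {p : ℂ} {x : ℝ}

lemma hasMellin_mul_cpow (hx : 0 < x) (hk : MellinConvergent k p) (ρ : ℂ) :
    HasMellin (fun w => k w * (ρ * ((x / w : ℝ) : ℂ) ^ (-p))) 0
      (ρ * ((x : ℂ) ^ (-p) * mellin k p)) := by
  have hscale : ∀ w ∈ Ioi (0 : ℝ), (ρ * (x : ℂ) ^ (-p)) • ((w : ℂ) ^ (p - 1) • k w) =
      (w : ℂ) ^ ((0 : ℂ) - 1) • (k w * (ρ * ((x / w : ℝ) : ℂ) ^ (-p))) := by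
    intro w hw
    have := cpow_neg_mul_cpow_add hx hw 0 p
    rw [zero_add] at this
    simp only [smul_eq_mul]
    linear_combination ρ * k w * this
  constructor
  · exact (integrableOn_congr_fun hscale measurableSet_Ioi).1 (hk.smul (ρ * (x : ℂ) ^ (-p)))
  · rw [mellin, ← setIntegral_congr_fun measurableSet_Ioi hscale, integral_smul, mellin,
      smul_eq_mul]
    ring

lemma hasMellin_finset_sum {ι : Type*} (t : Finset ι) {f : ι → ℝ → ℂ} {s : ℂ} {m : ι → ℂ}
    (h : ∀ i ∈ t, HasMellin (f i) s (m i)) :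
    HasMellin (fun w => ∑ i ∈ t, f i w) s (∑ i ∈ t, m i) := by
  simp only [HasMellin, MellinConvergent, mellin, Finset.smul_sum]
  refine ⟨integrable_finsetSum _ fun i hi => (h i hi).1, ?_⟩
  rw [integral_finsetSum _ fun i hi => (h i hi).1]
  exact Finset.sum_congr rfl fun i hi => (h i hi).2

lemma hasMellin_mul_sum_cpow {ι : Type*} (t : Finset ι) {ρ q : ι → ℂ} (hx : 0 < x)
    (hk : ∀ i ∈ t, MellinConvergent k (q i)) :
    HasMellin (fun w => k w * ∑ i ∈ t, ρ i * ((x / w : ℝ) : ℂ) ^ (-q i)) 0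
      (∑ i ∈ t, ρ i * ((x : ℂ) ^ (-q i) * mellin k (q i))) := by
  simp only [Finset.mul_sum]
  exact hasMellin_finset_sum t fun i hi => hasMellin_mul_cpow hx (hk i hi) (ρ i)

lemma hasMellin_congr_Ioi {f g : ℝ → ℂ} {s m : ℂ} (hf : HasMellin f s m)
    (hfg : EqOn f g (Ioi 0)) : HasMellin g s m := by
  have hsmul : EqOn (fun w : ℝ => (w : ℂ) ^ (s - 1) • f w) (fun w => (w : ℂ) ^ (s - 1) • g w)
      (Ioi 0) := fun w hw => by simp only [hfg hw]
  exact ⟨(integrableOn_congr_fun hsmul measurableSet_Ioi).1 hf.1,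
    (setIntegral_congr_fun measurableSet_Ioi hsmul).symm.trans hf.2⟩

lemma ofReal_leftResidueSum (a b c : ℝ) {X : ℝ} (hX : 0 ≤ X) :
    (leftResidueSum a b c X : ℂ) =
      ∑ k ∈ Finset.range ⌈-b - c⌉₊, (leftResidue a b k : ℂ) * (X : ℂ) ^ (-(-b - k : ℂ)) := by
  rw [leftResidueSum]
  push_cast [ofReal_cpow hX]
  exact Finset.sum_congr rfl fun k _ => by ring_nf

lemma ofReal_leftResidueSum_inv (a b c : ℝ) {X : ℝ} (hX : 0 < X) :
    (leftResidueSum (1 - b) (1 - a) (-c) X⁻¹ : ℂ) =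
      ∑ k ∈ Finset.range ⌈-(1 - a) - -c⌉₊,
        (leftResidue (1 - b) (1 - a) k : ℂ) * (X : ℂ) ^ (-(1 - a + k : ℂ)) := by
  rw [ofReal_leftResidueSum _ _ _ (inv_nonneg.2 hX.le)]
  refine Finset.sum_congr rfl fun k _ => ?_
  rw [ofReal_inv, inv_cpow _ _ (by rw [arg_ofReal_of_nonneg hX.le]; exact Real.pi_pos.ne),
    ← cpow_neg]
  push_cast
  ring_nf

end MellinSum

section ContourValue

variable {a₁ b₁ a₂ b₂ a₃ b₃ x y : ℝ} {p q s z : ℂ} {C : BarnesContour} {P : MeijerBlock}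

lemma BarnesContour.line_mem_support (C : BarnesContour) (P : MeijerBlock) (u : ℝ) :
    (C.c + u * I : ℂ) ∈ C.support P :=
  Or.inl (by simp)

lemma BarnesContour.Admissible.mem_strip
    (hC : C.Admissible (block11 a₁ b₁) P (block11 a₃ b₃)) (hs : s ∈ C.support P) :
    (-b₃ < C.d s ∧ C.d s < 1 - a₃) ∧ -b₁ < s.re + C.d s ∧ s.re + C.d s < 1 - a₁ := by
  have hl₃ := hC.left_t s hs (-b₃) (mem_block11_leftPoles.2 ⟨0, by simp⟩)
  have hr₃ := hC.right_t s hs (1 - a₃) (mem_block11_rightPoles.2 ⟨0, by simp⟩)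
  have hl₁ := hC.left_st s hs (-b₁) (mem_block11_leftPoles.2 ⟨0, by simp⟩)
  have hr₁ := hC.right_st s hs (1 - a₁) (mem_block11_rightPoles.2 ⟨0, by simp⟩)
  simp only [neg_re, sub_re, one_re, ofReal_re] at hl₃ hr₃ hl₁ hr₁
  exact ⟨⟨hl₃, hr₃⟩, hl₁, hr₁⟩

lemma BarnesContour.Admissible.lt_one_add
    (hC : C.Admissible (block11 a₁ b₁) P (block11 a₃ b₃)) : a₁ < 1 + b₁ ∧ a₃ < 1 + b₃ := by
  obtain ⟨⟨hl₃, hr₃⟩, hl₁, hr₁⟩ := hC.mem_strip (C.line_mem_support P 0)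
  constructor <;> linarith

lemma BarnesContour.Admissible.re_mem_strip
    (hC : C.Admissible (block11 a₁ b₁) P (block11 a₃ b₃)) (hs : s ∈ C.support P) :
    a₃ - b₁ - 1 < s.re ∧ s.re < 1 - a₁ + b₃ := by
  obtain ⟨⟨hl₃, hr₃⟩, hl₁, hr₁⟩ := hC.mem_strip hs
  constructor <;> linarith

lemma BarnesContour.Admissible.re_mem_strip_of_mem_closedBall
    (hC : C.Admissible (block11 a₁ b₁) P (block11 a₃ b₃))
    (hp : p ∈ C.wrongLeft P ∪ C.wrongRight P) (hz : z ∈ Metric.closedBall p C.r) :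
    a₃ - b₁ - 1 < z.re ∧ z.re < 1 - a₁ + b₃ := by
  have hr := hC.r_pos
  have hright := hC.re_mem_strip (s := p + C.r) (Or.inr ⟨p, hp, by simp [abs_of_pos hr]⟩)
  have hleft := hC.re_mem_strip (s := p - C.r) (Or.inr ⟨p, hp, by simp [abs_of_pos hr]⟩)
  have hre : |(z - p).re| ≤ C.r := (abs_re_le_norm _).trans (by rwa [← dist_eq])
  simp only [add_re, sub_re, ofReal_re] at hright hleft hre
  rw [abs_le] at hre
  constructor <;> linarith

lemma BarnesContour.Admissible.mellinConvergent_innerDensity (hy : 0 < y)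
    (hC : C.Admissible (block11 a₁ b₁) P (block11 a₃ b₃))
    (hp : p ∈ C.wrongLeft P ∪ C.wrongRight P) :
    MellinConvergent (fun w => (innerDensity a₁ b₁ a₃ b₃ y w : ℂ)) p := by
  obtain ⟨hl, hr⟩ := hC.re_mem_strip_of_mem_closedBall hp (Metric.mem_closedBall_self hC.r_pos.le)
  exact _root_.mellinConvergent_innerDensity hC.lt_one_add.1 hC.lt_one_add.2 hy hl hr

lemma BarnesContour.Admissible.outerIntegrand_eq (hy : 0 < y)
    (hC : C.Admissible (block11 a₁ b₁) P (block11 a₃ b₃)) (hs : s ∈ C.support P) :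
    C.outerIntegrand (block11 a₁ b₁) P (block11 a₃ b₃) x y s = P.kernel s *
      ((x : ℂ) ^ (-s) * mellin (fun w => (innerDensity a₁ b₁ a₃ b₃ y w : ℂ)) s) := by
  obtain ⟨⟨hl₃, hr₃⟩, hl₁, hr₁⟩ := hC.mem_strip hs
  rw [← integral_innerIntegrand_eq_mellin hy hl₃ hr₃ hl₁ hr₁, ← mul_assoc]
  rfl

lemma BarnesContour.Admissible.differentiableOn_cpow_mul_mellin (hx : 0 < x) (hy : 0 < y)
    (hC : C.Admissible (block11 a₁ b₁) P (block11 a₃ b₃))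
    (hp : p ∈ C.wrongLeft P ∪ C.wrongRight P) :
    DifferentiableOn ℂ (fun s => (x : ℂ) ^ (-s) *
      mellin (fun w => (innerDensity a₁ b₁ a₃ b₃ y w : ℂ)) s) (Metric.closedBall p C.r) := by
  intro z hz
  obtain ⟨hl, hr⟩ := hC.re_mem_strip_of_mem_closedBall hp hz
  refine DifferentiableAt.differentiableWithinAt (DifferentiableAt.mul ?_
    (differentiableAt_mellin_innerDensity hC.lt_one_add.1 hC.lt_one_add.2 hy hl hr))
  exact DifferentiableAt.const_cpow (by fun_prop) (Or.inl (ofReal_ne_zero.2 hx.ne'))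

lemma BarnesContour.Admissible.eq_center {P₁ P₃ : MeijerBlock} (hC : C.Admissible P₁ P P₃)
    (hp : p ∈ C.wrongLeft P ∪ C.wrongRight P) (hq : q ∈ P.leftPoles ∪ P.rightPoles)
    (hqp : q ∈ Metric.closedBall p C.r) : q = p := by
  by_contra h
  exact absurd (hC.circle_pole p hp q hq h) (not_lt.2 hqp)

lemma BarnesContour.Admissible.circleIntegrable (hx : 0 < x) (hy : 0 < y)
    (hC : C.Admissible (block11 a₁ b₁) (block11 a₂ b₂) (block11 a₃ b₃))
    (hp : p ∈ C.wrongLeft (block11 a₂ b₂) ∪ C.wrongRight (block11 a₂ b₂)) :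
    CircleIntegrable
      (C.outerIntegrand (block11 a₁ b₁) (block11 a₂ b₂) (block11 a₃ b₃) x y) p C.r := by
  refine ContinuousOn.circleIntegrable hC.r_pos.le ?_
  have hkernel : ContinuousOn (block11 a₂ b₂).kernel (Metric.sphere p C.r) := fun z hz => by
    refine (differentiableAt_block11_kernel fun hz' => ?_).continuousAt.continuousWithinAt
    rw [hC.eq_center hp hz' (Metric.sphere_subset_closedBall hz), Metric.mem_sphere,
      dist_self] at hz
    exact hC.r_pos.ne hz
  exact (hkernel.mul ((hC.differentiableOn_cpow_mul_mellin hx hy hp).continuousOn.mono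
    Metric.sphere_subset_closedBall)).congr fun z hz =>
      hC.outerIntegrand_eq hy (Or.inr ⟨p, hp, hz⟩)

lemma BarnesContour.Admissible.loop_eq (hy : 0 < y)
    (hC : C.Admissible (block11 a₁ b₁) P (block11 a₃ b₃))
    (hp : p ∈ C.wrongLeft P ∪ C.wrongRight P) :
    C.loop (block11 a₁ b₁) P (block11 a₃ b₃) x y p = (2 * Real.pi * I)⁻¹ *
      ∮ z in C(p, C.r), P.kernel z *
        ((x : ℂ) ^ (-z) * mellin (fun w => (innerDensity a₁ b₁ a₃ b₃ y w : ℂ)) z) := by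
  rw [BarnesContour.loop, circleIntegral.integral_congr hC.r_pos.le
    fun z hz => hC.outerIntegrand_eq hy (Or.inr ⟨p, hp, hz⟩)]

lemma BarnesContour.wrongLeft_block11 (C : BarnesContour) (a b : ℝ) :
    C.wrongLeft (block11 a b) =
      (fun k : ℕ => (-b - k : ℂ)) '' (Finset.range ⌈-b - C.c⌉₊ : Set ℕ) := by
  ext p
  simp only [wrongLeft, mem_ofPred_eq, mem_block11_leftPoles, mem_image, Finset.coe_range,
    mem_Iio, Nat.lt_ceil]
  constructor
  · rintro ⟨⟨k, rfl⟩, hk⟩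
    simp only [sub_re, neg_re, ofReal_re, natCast_re] at hk
    exact ⟨k, by linarith, rfl⟩
  · rintro ⟨k, hk, rfl⟩
    simp only [sub_re, neg_re, ofReal_re, natCast_re]
    exact ⟨⟨k, rfl⟩, by linarith⟩

lemma BarnesContour.wrongRight_block11 (C : BarnesContour) (a b : ℝ) :
    C.wrongRight (block11 a b) =
      (fun k : ℕ => (1 - a + k : ℂ)) '' (Finset.range ⌈-(1 - a) - -C.c⌉₊ : Set ℕ) := by
  ext p
  simp only [wrongRight, mem_ofPred_eq, mem_block11_rightPoles, mem_image, Finset.coe_range,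
    mem_Iio, Nat.lt_ceil]
  constructor
  · rintro ⟨⟨k, rfl⟩, hk⟩
    simp only [add_re, sub_re, one_re, ofReal_re, natCast_re] at hk
    exact ⟨k, by linarith, rfl⟩
  · rintro ⟨k, hk, rfl⟩
    simp only [add_re, sub_re, one_re, ofReal_re, natCast_re]
    exact ⟨⟨k, rfl⟩, by linarith⟩

lemma hasMellin_wrongLeft (hab : ∀ n : ℤ, b₂ - a₂ ≠ n) (hx : 0 < x) (hy : 0 < y)
    (hC : C.Admissible (block11 a₁ b₁) (block11 a₂ b₂) (block11 a₃ b₃)) :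
    HasMellin (fun w => (innerDensity a₁ b₁ a₃ b₃ y w : ℂ) * leftResidueSum a₂ b₂ C.c (x / w)) 0
      (∑ᶠ p ∈ C.wrongLeft (block11 a₂ b₂),
        C.loop (block11 a₁ b₁) (block11 a₂ b₂) (block11 a₃ b₃) x y p) := by
  have hmem (k : ℕ) (hk : k ∈ Finset.range ⌈-b₂ - C.c⌉₊) :
      (-b₂ - k : ℂ) ∈ C.wrongLeft (block11 a₂ b₂) ∪ C.wrongRight (block11 a₂ b₂) :=
    Or.inl (C.wrongLeft_block11 a₂ b₂ ▸ mem_image_of_mem _ hk)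
  rw [C.wrongLeft_block11,
    finsum_mem_image (fun i _ k _ hik => Nat.cast_injective (sub_right_inj.1 hik)),
    finsum_mem_coe_finset, Finset.sum_congr rfl fun k hk => by
      rw [hC.loop_eq hy (hmem k hk), circleIntegral_block11_kernel_left k hab hC.r_pos
        (hC.differentiableOn_cpow_mul_mellin hx hy (hmem k hk))
        fun q hq hqp => hC.eq_center (hmem k hk) hq hqp]]
  refine hasMellin_congr_Ioi (hasMellin_mul_sum_cpow _ hx fun k hk =>
    hC.mellinConvergent_innerDensity hy (hmem k hk)) fun w (hw : 0 < w) => ?_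
  rw [ofReal_leftResidueSum _ _ _ (by positivity)]

lemma hasMellin_wrongRight (hab : ∀ n : ℤ, b₂ - a₂ ≠ n) (hx : 0 < x) (hy : 0 < y)
    (hC : C.Admissible (block11 a₁ b₁) (block11 a₂ b₂) (block11 a₃ b₃)) :
    HasMellin (fun w => (innerDensity a₁ b₁ a₃ b₃ y w : ℂ) *
        leftResidueSum (1 - b₂) (1 - a₂) (-C.c) (x / w)⁻¹) 0
      (-∑ᶠ p ∈ C.wrongRight (block11 a₂ b₂),
        C.loop (block11 a₁ b₁) (block11 a₂ b₂) (block11 a₃ b₃) x y p) := by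
  have hmem (k : ℕ) (hk : k ∈ Finset.range ⌈-(1 - a₂) - -C.c⌉₊) :
      (1 - a₂ + k : ℂ) ∈ C.wrongLeft (block11 a₂ b₂) ∪ C.wrongRight (block11 a₂ b₂) :=
    Or.inr (C.wrongRight_block11 a₂ b₂ ▸ mem_image_of_mem _ hk)
  rw [C.wrongRight_block11,
    finsum_mem_image (fun i _ k _ hik => Nat.cast_injective (add_left_cancel hik)),
    finsum_mem_coe_finset, Finset.sum_congr rfl fun k hk => by
      rw [hC.loop_eq hy (hmem k hk), circleIntegral_block11_kernel_right k hab hC.r_pos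
        (hC.differentiableOn_cpow_mul_mellin hx hy (hmem k hk))
        fun q hq hqp => hC.eq_center (hmem k hk) hq hqp],
    Finset.sum_neg_distrib, neg_neg]
  refine hasMellin_congr_Ioi (hasMellin_mul_sum_cpow _ hx fun k hk =>
    hC.mellinConvergent_innerDensity hy (hmem k hk)) fun w (hw : 0 < w) => ?_
  rw [ofReal_leftResidueSum_inv _ _ _ (by positivity)]

lemma BarnesContour.Admissible.outerIntegrand_line_eq (hy : 0 < y)
    (hC : C.Admissible (block11 a₁ b₁) P (block11 a₃ b₃)) (u : ℝ) :
    C.outerIntegrand (block11 a₁ b₁) P (block11 a₃ b₃) x y (C.c + u * I) =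
      mellin (fun w => (innerDensity a₁ b₁ a₃ b₃ y w : ℂ)) (0 + (C.c + u * I)) *
        P.kernel (C.c + u * I) * (x : ℂ) ^ (-(C.c + u * I : ℂ)) := by
  rw [hC.outerIntegrand_eq hy (C.line_mem_support P u), zero_add]
  ring

lemma BarnesContour.Admissible.mellinConvergent_innerDensity_line (hy : 0 < y)
    (hC : C.Admissible (block11 a₁ b₁) P (block11 a₃ b₃)) :
    MellinConvergent (fun w => (innerDensity a₁ b₁ a₃ b₃ y w : ℂ)) (0 + C.c) := by
  have hstrip := hC.re_mem_strip (s := C.c) (Or.inl (ofReal_re _))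
  rw [zero_add]
  exact _root_.mellinConvergent_innerDensity hC.lt_one_add.1 hC.lt_one_add.2 hy hstrip.1 hstrip.2

lemma BarnesContour.Admissible.converges (hx : 0 < x) (hy : 0 < y)
    (hC : C.Admissible (block11 a₁ b₁) (block11 a₂ b₂) (block11 a₃ b₃)) :
    C.Converges (block11 a₁ b₁) (block11 a₂ b₂) (block11 a₃ b₃) x y where
  inner s hs :=
    let ⟨⟨hl₃, hr₃⟩, hl₁, hr₁⟩ := hC.mem_strip hs
    integrable_innerIntegrand hy hl₃ hr₃ hl₁ hr₁
  line := by
    simp only [hC.outerIntegrand_line_eq hy]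
    exact integrable_mellin_mul_cpow (hC.mellinConvergent_innerDensity_line hy)
      (integrable_kernel_line hC.line) hx
  circle p hp := hC.circleIntegrable hx hy hp

lemma hasMellin_line (hx : 0 < x) (hy : 0 < y)
    (hC : C.Admissible (block11 a₁ b₁) (block11 a₂ b₂) (block11 a₃ b₃)) :
    HasMellin (fun w => (innerDensity a₁ b₁ a₃ b₃ y w : ℂ) *
        mellinInv C.c (block11 a₂ b₂).kernel (x / w)) 0
      ((2 * Real.pi : ℂ)⁻¹ * ∫ u : ℝ,
        C.outerIntegrand (block11 a₁ b₁) (block11 a₂ b₂) (block11 a₃ b₃) x y (C.c + u * I)) := by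
  have hK := hC.mellinConvergent_innerDensity_line hy
  have hkernel := integrable_kernel_line hC.line
  refine ⟨mellinConvergent_mul_mellinInv hK hkernel hx, ?_⟩
  simp only [hC.outerIntegrand_line_eq hy]
  exact (integral_mellin_mul_cpow_eq_mellin hK hkernel hx).symm

lemma hasMellin_value (hab : ∀ n : ℤ, b₂ - a₂ ≠ n) (hx : 0 < x) (hy : 0 < y)
    (hC : C.Admissible (block11 a₁ b₁) (block11 a₂ b₂) (block11 a₃ b₃)) :
    HasMellin (fun w => (innerDensity a₁ b₁ a₃ b₃ y w : ℂ) * meijerG11 a₂ b₂ (x / w)) 0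
      (C.value (block11 a₁ b₁) (block11 a₂ b₂) (block11 a₃ b₃) x y) := by
  have hline := hasMellin_line hx hy hC
  have hleft := hasMellin_wrongLeft hab hx hy hC
  have hright := hasMellin_wrongRight hab hx hy hC
  have hsum := hasMellin_add hline.1 hleft.1
  have htotal := hasMellin_add hsum.1 hright.1
  rw [hsum.2, hline.2, hleft.2, hright.2, ← sub_eq_add_neg] at htotal
  refine hasMellin_congr_Ioi htotal fun w (hw : 0 < w) => ?_
  simp only [mellinInv_block11_kernel_eq hC.line hab (div_pos hx hw), meijerG11Remainder]
  push_cast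
  ring

/-- The value at `(x, y)` of the bivariate G-function with blocks `block11 a₁ b₁`, `block11 a₂ b₂`
and `block11 a₃ b₃`, as the Mellin convolution of the three univariate functions. -/
def meijerG11Convolution (a₁ b₁ a₂ b₂ a₃ b₃ x y : ℝ) : ℝ :=
  ∫ w in Ioi 0, w⁻¹ * (innerDensity a₁ b₁ a₃ b₃ y w * meijerG11 a₂ b₂ (x / w))

theorem isEGBMGF_block11 (h₁ : a₁ < 1 + b₁) (h₃ : a₃ < 1 + b₃) (hab : ∀ n : ℤ, b₂ - a₂ ≠ n)
    (hb : -b₂ < 1 - a₁ + b₃) (ha : a₃ - b₁ - 1 < 1 - a₂) (hx : 0 < x) (hy : 0 < y) :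
    IsEGBMGF (block11 a₁ b₁) (block11 a₂ b₂) (block11 a₃ b₃) x y
      (meijerG11Convolution a₁ b₁ a₂ b₂ a₃ b₃ x y) := by
  refine ⟨exists_admissible h₁ h₃ hab hb ha, fun C hC => ⟨hC.converges hx hy, ?_⟩⟩
  rw [← (hasMellin_value hab hx hy hC).2, mellin, meijerG11Convolution,
    ← integral_complex_ofReal]
  refine setIntegral_congr_fun measurableSet_Ioi fun w _ => ?_
  rw [zero_sub, cpow_neg_one, smul_eq_mul]
  push_cast
  rfl

lemma IsEGBMGF.egbmgf_eq {P₁ P₂ P₃ : MeijerBlock} {v : ℂ} (h : IsEGBMGF P₁ P₂ P₃ x y v) :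
    egbmgf P₁ P₂ P₃ x y = v := by
  have hv : ∃ v, IsEGBMGF P₁ P₂ P₃ x y v := ⟨v, h⟩
  obtain ⟨C, hC⟩ := h.1
  rw [egbmgf, dif_pos hv, ← (hv.choose_spec.2 C hC).2, (h.2 C hC).2]

end ContourValue

section Gamma

lemma gammaMeasure_eq_restrict (a r : ℝ) :
    gammaMeasure a r = (volume.restrict (Ioi 0)).withDensity (gammaPDF a r) := by
  rw [gammaMeasure, restrict_Ioi_eq_restrict_Ici, ← restrict_withDensity measurableSet_Ici]
  refine (Measure.restrict_eq_self_of_ae_mem ?_).symm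
  rw [ae_iff]
  change volume.withDensity _ (Ici 0)ᶜ = 0
  rw [compl_Ici, withDensity_apply _ measurableSet_Iio]
  exact lintegral_gammaPDF_of_nonpos le_rfl

lemma measurable_gammaPDF (a r : ℝ) : Measurable (gammaPDF a r) :=
  (measurable_gammaPDFReal a r).ennreal_ofReal

lemma lintegral_gammaMeasure (a r : ℝ) {f : ℝ → ENNReal} (hf : Measurable f) :
    ∫⁻ x, f x ∂gammaMeasure a r = ∫⁻ x in Ioi 0, gammaPDF a r x * f x := by
  rw [gammaMeasure_eq_restrict,
    lintegral_withDensity_eq_lintegral_mul _ (measurable_gammaPDF a r) hf]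
  rfl

lemma setLIntegral_gammaPDF_Ioi {a r : ℝ} (ha : 0 < a) (hr : 0 < r) :
    ∫⁻ x in Ioi 0, gammaPDF a r x = 1 := by
  have := isProbabilityMeasure_gammaMeasure ha hr
  simpa using (lintegral_gammaMeasure a r (f := 1) measurable_const).symm

lemma ae_gammaMeasure_pos (a r : ℝ) : ∀ᵐ x ∂gammaMeasure a r, 0 < x := by
  rw [gammaMeasure_eq_restrict]
  exact (withDensity_absolutelyContinuous _ _).ae_le (ae_restrict_mem measurableSet_Ioi)

lemma gammaMeasure_Ici (a r z : ℝ) : gammaMeasure a r (Ici z) = gammaMeasure a r (Ioi z) := by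
  rw [gammaMeasure, withDensity_apply _ measurableSet_Ici, withDensity_apply _ measurableSet_Ioi,
    restrict_Ioi_eq_restrict_Ici]

lemma mgf_gammaMeasure {a r t : ℝ} (ha : 0 < a) (hr : 0 < r) (ht : t < r) :
    mgf id (gammaMeasure a r) t = (r / (r - t)) ^ a := by
  have hrt : 0 < r - t := sub_pos.2 ht
  have hΓ : Real.Gamma a ≠ 0 := (Real.Gamma_pos_of_pos ha).ne'
  rw [mgf, gammaMeasure_eq_restrict,
    integral_withDensity_eq_integral_toReal_smul (measurable_gammaPDF _ _)
      (ae_of_all _ fun _ => ENNReal.ofReal_lt_top)]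
  calc ∫ x in Ioi 0, (gammaPDF a r x).toReal • Real.exp (t * id x)
      = ∫ x in Ioi 0, r ^ a / Real.Gamma a * (x ^ (a - 1) * Real.exp (-((r - t) * x))) := by
        refine setIntegral_congr_fun measurableSet_Ioi fun x (hx : 0 < x) => ?_
        rw [gammaPDF, ENNReal.toReal_ofReal (gammaPDFReal_nonneg ha hr x), gammaPDFReal,
          if_pos hx.le, show -((r - t) * x) = -(r * x) + t * x by ring, Real.exp_add]
        simp only [id_eq, smul_eq_mul]
        ring
    _ = (r / (r - t)) ^ a := by
        rw [integral_const_mul, Real.integral_rpow_mul_exp_neg_mul_Ioi ha hrt,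
          Real.div_rpow hr.le hrt.le, Real.div_rpow zero_le_one hrt.le, Real.one_rpow]
        field_simp

lemma eq_of_mgf_eqOn_Ioo {μ μ' : Measure ℝ} [IsProbabilityMeasure μ] [IsProbabilityMeasure μ']
    {r : ℝ} (hr : 0 < r) (h0 : ∀ t ∈ Ioo (-r) r, mgf id μ t ≠ 0)
    (h : EqOn (mgf id μ) (mgf id μ') (Ioo (-r) r)) : μ = μ' := by
  have hint : ∀ ν : Measure ℝ, (∀ t ∈ Ioo (-r) r, mgf id ν t ≠ 0) →
      Ioo (-r) r ⊆ interior (integrableExpSet id ν) := fun ν hν =>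
    isOpen_Ioo.subset_interior_iff.2 fun t ht => not_imp_comm.1 mgf_undef (hν t ht)
  have han : ∀ ν : Measure ℝ, (∀ t ∈ Ioo (-r) r, mgf id ν t ≠ 0) →
      AnalyticOnNhd ℂ (complexMGF id ν) (re ⁻¹' Ioo (-r) r) := fun ν hν =>
    analyticOnNhd_complexMGF.mono fun z hz => hint ν hν hz
  have hconn : IsPreconnected (re ⁻¹' Ioo (-r) r) :=
    ((convex_Ioo (-r) r).linear_preimage reLm).isPreconnected
  have hreal : Tendsto ((↑) : ℝ → ℂ) (𝓝[≠] 0) (𝓝[≠] 0) :=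
    continuous_ofReal.continuousWithinAt.tendsto_nhdsWithin fun t ht => ofReal_injective.ne ht
  have hnear : ∀ᶠ t : ℝ in 𝓝[≠] 0, complexMGF id μ t = complexMGF id μ' t := by
    filter_upwards [nhdsWithin_le_nhds (Ioo_mem_nhds (neg_neg_of_pos hr) hr)] with t ht
    rw [complexMGF_ofReal, complexMGF_ofReal, h ht]
  have heq : EqOn (complexMGF id μ) (complexMGF id μ') (re ⁻¹' Ioo (-r) r) :=
    (han μ h0).eqOn_of_preconnected_of_frequently_eq (han μ' fun t ht => h ht ▸ h0 t ht) hconn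
      (z₀ := 0) (by simp [hr])
      (hreal.frequently (p := fun z => complexMGF id μ z = complexMGF id μ' z) hnear.frequently)
  refine Measure.ext_of_charFun (funext fun t => ?_)
  rw [← complexMGF_id_mul_I, ← complexMGF_id_mul_I, heq (by simp [hr])]

lemma eq_gammaMeasure_of_mgf_eq {μ : Measure ℝ} [IsProbabilityMeasure μ] {a r : ℝ} (ha : 0 < a)
    (hr : 0 < r) (h : ∀ t < r, mgf id μ t = (r / (r - t)) ^ a) : μ = gammaMeasure a r := by
  have := isProbabilityMeasure_gammaMeasure ha hr
  refine eq_of_mgf_eqOn_Ioo hr (fun t ht => ?_) fun t ht => ?_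
  · have : 0 < r - t := sub_pos.2 ht.2
    rw [h t ht.2]
    positivity
  · rw [h t ht.2, mgf_gammaMeasure ha hr ht.2]

lemma gammaPDFReal_natCast {n : ℕ} (hn : n ≠ 0) (r : ℝ) {x : ℝ} (hx : 0 < x) :
    gammaPDFReal n r x = r * (r * x) ^ (n - 1) / (n - 1).factorial * Real.exp (-(r * x)) := by
  obtain ⟨n, rfl⟩ := Nat.exists_eq_succ_of_ne_zero hn
  rw [gammaPDFReal, if_pos hx.le, Nat.cast_succ, Real.Gamma_nat_eq_factorial, add_sub_cancel_right,
    ← Nat.cast_succ, Real.rpow_natCast, Real.rpow_natCast, Nat.succ_sub_one, mul_pow, pow_succ]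
  ring

/-- `ℙ(X > x)` for `X` of the Erlang law with shape `n` and rate `r`. -/
def erlangTail (r : ℝ) (n : ℕ) (x : ℝ) : ℝ :=
  Real.exp (-(r * x)) * ∑ k ∈ Finset.range n, (r * x) ^ k / k.factorial

lemma hasDerivAt_erlangTail (r : ℝ) {n : ℕ} (hn : 1 ≤ n) (x : ℝ) :
    HasDerivAt (erlangTail r n)
      (-(r * (r * x) ^ (n - 1) / (n - 1).factorial * Real.exp (-(r * x)))) x := by
  have hlin : HasDerivAt (fun x : ℝ => r * x) r x := by simpa using (hasDerivAt_id x).const_mul r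
  have hexp : HasDerivAt (fun x => Real.exp (-(r * x))) (Real.exp (-(r * x)) * -r) x :=
    hlin.neg.exp
  induction n, hn using Nat.le_induction with
  | base =>
    convert! hexp using 1
    · ext x
      simp [erlangTail]
    · simp [mul_comm]
  | succ n hn ih =>
    obtain ⟨m, rfl⟩ := Nat.exists_eq_succ_of_ne_zero (Nat.one_le_iff_ne_zero.1 hn)
    convert! ih.add (hexp.mul ((hlin.pow (m + 1)).div_const ((m + 1).factorial : ℝ))) using 1
    · ext x
      simp only [erlangTail, Finset.sum_range_succ _ (m + 1), Nat.succ_eq_add_one, Pi.add_apply,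
        Pi.mul_apply, Pi.pow_apply]
      ring
    · simp only [Nat.succ_eq_add_one, Nat.add_sub_cancel, Pi.pow_apply, Nat.factorial_succ]
      push_cast
      field_simp
      ring

lemma tendsto_erlangTail {r : ℝ} (hr : 0 < r) (n : ℕ) :
    Tendsto (erlangTail r n) atTop (𝓝 0) := by
  have h : Tendsto (fun x : ℝ => ∑ k ∈ Finset.range n,
      r ^ k / k.factorial * (x ^ k * Real.exp (-(r * x)))) atTop (𝓝 0) := by
    have := tendsto_finsetSum (Finset.range n) fun k _ =>
      (tendsto_rpow_mul_exp_neg_mul_atTop_nhds_zero k r hr).const_mul (r ^ k / k.factorial)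
    simpa using this
  refine h.congr fun x => ?_
  rw [erlangTail, Finset.mul_sum]
  refine Finset.sum_congr rfl fun k _ => ?_
  ring

lemma gammaMeasure_natCast_Ioi {n : ℕ} (hn : 1 ≤ n) {r z : ℝ} (hr : 0 < r) (hz : 0 ≤ z) :
    gammaMeasure n r (Ioi z) = ENNReal.ofReal (erlangTail r n z) := by
  set f : ℝ → ℝ := fun x => r * (r * x) ^ (n - 1) / (n - 1).factorial * Real.exp (-(r * x))
  have hpos : ∀ x ∈ Ioi z, 0 ≤ f x := fun x hx => by
    have : 0 < x := hz.trans_lt hx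
    positivity
  have hderiv := integrableOn_Ioi_deriv_of_nonpos' (fun x _ => hasDerivAt_erlangTail r hn x)
    (fun x hx => neg_nonpos.2 (hpos x hx)) (tendsto_erlangTail hr n)
  have hint : IntegrableOn f (Ioi z) := by simpa [f, Pi.neg_def] using hderiv.neg
  have heq := integral_Ioi_of_hasDerivAt_of_nonpos' (fun x _ => hasDerivAt_erlangTail r hn x)
    (fun x hx => neg_nonpos.2 (hpos x hx)) (tendsto_erlangTail hr n)
  have hval : erlangTail r n z = ∫ x in Ioi z, f x := by
    rw [integral_neg] at heq
    linarith
  rw [hval, ofReal_integral_eq_lintegral_ofReal hint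
    ((ae_restrict_iff' measurableSet_Ioi).2 (ae_of_all _ hpos)), gammaMeasure,
    withDensity_apply _ measurableSet_Ioi]
  refine setLIntegral_congr_fun measurableSet_Ioi fun x hx => ?_
  rw [gammaPDF, gammaPDFReal_natCast (by lia) r (hz.trans_lt hx)]

variable {E : Type*} [MeasurableSpace E] {P : Measure E}

lemma mgf_of_hasLaw_gammaMeasure {X : E → ℝ} {a r t : ℝ} (ha : 0 < a) (hr : 0 < r)
    (hX : HasLaw X (gammaMeasure a r) P) (ht : t < r) : mgf X P t = (r / (r - t)) ^ a := by
  rw [← mgf_id_map hX.aemeasurable, hX.map_eq, mgf_gammaMeasure ha hr ht]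

variable [IsProbabilityMeasure P]

lemma hasLaw_gammaMeasure_of_mgf_eq {X : E → ℝ} {a r : ℝ} (ha : 0 < a) (hr : 0 < r)
    (hX : AEMeasurable X P) (h : ∀ t < r, mgf X P t = (r / (r - t)) ^ a) :
    HasLaw X (gammaMeasure a r) P := by
  have := Measure.isProbabilityMeasure_map hX
  exact ⟨hX, eq_gammaMeasure_of_mgf_eq ha hr fun t ht => by rw [mgf_id_map hX, h t ht]⟩

lemma hasLaw_const_mul_gammaMeasure {X : E → ℝ} {a r c : ℝ} (ha : 0 < a) (hr : 0 < r)
    (hc : 0 < c) (hX : HasLaw X (gammaMeasure a r) P) :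
    HasLaw (fun ω => c * X ω) (gammaMeasure a (r / c)) P := by
  refine hasLaw_gammaMeasure_of_mgf_eq ha (div_pos hr hc) (hX.aemeasurable.const_mul c)
    fun t ht => ?_
  rw [mgf_const_mul, mgf_of_hasLaw_gammaMeasure ha hr hX ((lt_div_iff₀' hc).1 ht)]
  congr 1
  field_simp

lemma hasLaw_sum_gammaMeasure {ι : Type*} [Fintype ι] [Nonempty ι] {X : ι → E → ℝ} {a : ι → ℝ}
    {r : ℝ} (ha : ∀ i, 0 < a i) (hr : 0 < r) (hX : ∀ i, HasLaw (X i) (gammaMeasure (a i) r) P)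
    (hind : iIndepFun X P) :
    HasLaw (fun ω => ∑ i, X i ω) (gammaMeasure (∑ i, a i) r) P := by
  have hm : ∀ i, AEMeasurable (X i) P := fun i => (hX i).aemeasurable
  refine hasLaw_gammaMeasure_of_mgf_eq (Finset.sum_pos (fun i _ => ha i) Finset.univ_nonempty) hr
    (Finset.aemeasurable_fun_sum _ fun i _ => hm i) fun t ht => ?_
  have hsum : (fun ω => ∑ i, X i ω) = ∑ i, X i := by
    ext ω
    rw [Finset.sum_apply]
  rw [hsum, hind.mgf_sum₀ hm, Real.rpow_sum_of_pos (div_pos hr (sub_pos.2 ht)) a]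
  exact Finset.prod_congr rfl fun i _ => mgf_of_hasLaw_gammaMeasure (ha i) hr (hX i) ht

end Gamma

section Gaussian

lemma integral_exp_mul_sq_gaussianReal (t : ℝ) :
    ∫ x, Real.exp (t * x ^ 2) ∂gaussianReal 0 (1 / 2) = (√(1 - t))⁻¹ := by
  have hv : 2 * ((1 / 2 : NNReal) : ℝ) = 1 := by norm_num
  rw [integral_gaussianReal_eq_integral_smul (by simp)]
  calc ∫ x, gaussianPDFReal 0 (1 / 2) x • Real.exp (t * x ^ 2)
      = ∫ x, (√Real.pi)⁻¹ * Real.exp (-(1 - t) * x ^ 2) := by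
        congr with x
        rw [gaussianPDFReal, mul_right_comm, hv, smul_eq_mul, mul_assoc, ← Real.exp_add]
        ring_nf
    _ = (√(1 - t))⁻¹ := by
        rw [integral_const_mul, integral_gaussian, Real.sqrt_div Real.pi_pos.le]
        field_simp

lemma mgf_normSq_stdComplexGaussian {t : ℝ} (ht : t < 1) :
    mgf (fun z => ‖z‖ ^ 2) stdComplexGaussian t = (1 - t)⁻¹ := by
  rw [mgf, stdComplexGaussian, integral_map_equiv]
  calc _ = ∫ p : ℝ × ℝ, Real.exp (t * p.1 ^ 2) * Real.exp (t * p.2 ^ 2)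
        ∂(gaussianReal 0 (1 / 2)).prod (gaussianReal 0 (1 / 2)) := by
        congr with p
        rw [← Real.exp_add, ← normSq_eq_norm_sq, normSq_apply]
        simp only [measurableEquivRealProd_symm_apply]
        ring_nf
    _ = (1 - t)⁻¹ := by
        rw [integral_prod_mul (fun x => Real.exp (t * x ^ 2)) fun x => Real.exp (t * x ^ 2),
          integral_exp_mul_sq_gaussianReal t, ← mul_inv, Real.mul_self_sqrt (sub_pos.2 ht).le]

variable {E : Type*} [MeasurableSpace E] {P : Measure E} [IsProbabilityMeasure P]

lemma hasLaw_gain {h : E → ℂ} (hh : HasLaw h stdComplexGaussian P) {Ω : ℝ} (hΩ : 0 < Ω) :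
    HasLaw (fun ω => ‖(√Ω : ℂ) * h ω‖ ^ 2) (gammaMeasure 1 (1 / Ω)) P := by
  have hm : AEMeasurable (fun ω => ‖h ω‖ ^ 2) P := by
    have := hh.aemeasurable
    fun_prop
  have hnorm : HasLaw (fun ω => ‖h ω‖ ^ 2) (gammaMeasure 1 1) P :=
    hasLaw_gammaMeasure_of_mgf_eq one_pos one_pos hm fun t ht => by
      rw [Real.rpow_one, one_div, ← mgf_normSq_stdComplexGaussian ht, ← hh.map_eq,
        mgf_map hh.aemeasurable (by fun_prop)]
      rfl
  refine (hasLaw_const_mul_gammaMeasure one_pos one_pos hΩ hnorm).congr (ae_of_all _ fun ω => ?_)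
  simp only [norm_mul, mul_pow, Complex.norm_real, Real.norm_of_nonneg (Real.sqrt_nonneg _),
    Real.sq_sqrt hΩ.le]

lemma hasLaw_sum_gain {ι : Type*} [Fintype ι] [Nonempty ι] {h : ι → E → ℂ}
    (hlaw : ∀ i, HasLaw (h i) stdComplexGaussian P) (hind : iIndepFun h P) {Ω : ℝ} (hΩ : 0 < Ω) :
    HasLaw (fun ω => ∑ i, ‖(√Ω : ℂ) * h i ω‖ ^ 2) (gammaMeasure (Fintype.card ι) (1 / Ω)) P := by
  simpa using hasLaw_sum_gammaMeasure (fun _ => one_pos) (one_div_pos.2 hΩ)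
    (fun i => hasLaw_gain (hlaw i) hΩ)
    (hind.comp (fun _ z => ‖(√Ω : ℂ) * z‖ ^ 2) fun _ => by fun_prop)

end Gaussian

section MinLaw

lemma lintegral_min_prod {α : Type*} [LinearOrder α] [TopologicalSpace α] [OrderClosedTopology α]
    [SecondCountableTopology α] [MeasurableSpace α] [BorelSpace α] (μ ν : Measure α) [SFinite μ]
    [SFinite ν] {f : α → ENNReal} (hf : Measurable f) :
    ∫⁻ p : α × α, f (min p.1 p.2) ∂μ.prod ν =
      ∫⁻ z, f z * ν (Ioi z) ∂μ + ∫⁻ z, f z * μ (Ici z) ∂ν := by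
  have hs : MeasurableSet {p : α × α | p.1 < p.2} := measurableSet_lt measurable_fst measurable_snd
  rw [← lintegral_add_compl _ hs]
  congr 1
  · calc _ = ∫⁻ p in {p : α × α | p.1 < p.2}, f p.1 ∂μ.prod ν :=
          setLIntegral_congr_fun hs fun p hp => by simp only [min_eq_left (le_of_lt hp)]
      _ = ∫⁻ z, ∫⁻ _ in Ioi z, f z ∂ν ∂μ := by
          rw [← lintegral_indicator hs, lintegral_prod _ (by fun_prop (disch := exact hs))]
          simp only [← lintegral_indicator measurableSet_Ioi]
          rfl
      _ = _ := by simp only [setLIntegral_const]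
  · calc _ = ∫⁻ p in {p : α × α | p.1 < p.2}ᶜ, f p.2 ∂μ.prod ν :=
          setLIntegral_congr_fun hs.compl fun p hp => by
            simp only [min_eq_right (not_lt.1 hp)]
      _ = ∫⁻ z, ∫⁻ _ in Ici z, f z ∂μ ∂ν := by
          rw [← lintegral_indicator hs.compl, lintegral_prod_symm _
            (by fun_prop (disch := exact hs.compl))]
          simp only [← lintegral_indicator measurableSet_Ici]
          simp [indicator_apply]
      _ = _ := by simp only [setLIntegral_const]

/-- The probability that a Poisson process of rate `r₂` has exactly `k` points before an independent
time of the gamma law with shape `a` and rate `r₁`. -/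
def negBinomialWeight (a r₁ r₂ : ℝ) (k : ℕ) : ℝ :=
  Real.Gamma (a + k) / (Real.Gamma a * k.factorial) * (r₁ / (r₁ + r₂)) ^ a * (r₂ / (r₁ + r₂)) ^ k

variable {a r r₁ r₂ : ℝ}

lemma negBinomialWeight_pos (ha : 0 < a) (h₁ : 0 < r₁) (h₂ : 0 < r₂) (k : ℕ) :
    0 < negBinomialWeight a r₁ r₂ k := by
  have := Real.Gamma_pos_of_pos ha
  have := Real.Gamma_pos_of_pos (show 0 < a + k by positivity)
  rw [negBinomialWeight]
  positivity

lemma gammaPDFReal_mul_erlangTail (ha : 0 < a) (h₁ : 0 < r₁) (h₂ : 0 < r₂) (n : ℕ) {z : ℝ}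
    (hz : 0 < z) :
    gammaPDFReal a r₁ z * erlangTail r₂ n z =
      ∑ k ∈ Finset.range n, negBinomialWeight a r₁ r₂ k * gammaPDFReal (a + k) (r₁ + r₂) z := by
  rw [erlangTail, Finset.mul_sum, Finset.mul_sum]
  refine Finset.sum_congr rfl fun k _ => ?_
  have h : 0 < r₁ + r₂ := add_pos h₁ h₂
  have hΓ : Real.Gamma (a + k) ≠ 0 := (Real.Gamma_pos_of_pos (by positivity)).ne'
  rw [gammaPDFReal, gammaPDFReal, if_pos hz.le, if_pos hz.le, negBinomialWeight,
    show -((r₁ + r₂) * z) = -(r₁ * z) + -(r₂ * z) by ring, Real.exp_add,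
    show a + k - 1 = a - 1 + k by ring, Real.rpow_add hz, Real.rpow_natCast,
    Real.div_rpow h₁.le h.le, Real.rpow_add h, Real.rpow_natCast, mul_pow, div_pow]
  have := Real.rpow_pos_of_pos h a
  field_simp

lemma lintegral_mul_gammaMeasure_Ioi (ha : 0 < a) (h₁ : 0 < r₁) (h₂ : 0 < r₂) {n : ℕ} (hn : 1 ≤ n)
    {f : ℝ → ENNReal} (hf : Measurable f) :
    ∫⁻ z, f z * gammaMeasure n r₂ (Ioi z) ∂gammaMeasure a r₁ =
      ∑ k ∈ Finset.range n, ENNReal.ofReal (negBinomialWeight a r₁ r₂ k) *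
        ∫⁻ z, f z ∂gammaMeasure (a + k) (r₁ + r₂) := by
  have hw : ∀ k, 0 ≤ negBinomialWeight a r₁ r₂ k := fun k => (negBinomialWeight_pos ha h₁ h₂ k).le
  have hPDF : ∀ k : ℕ, ∀ z, 0 ≤ gammaPDFReal (a + k) (r₁ + r₂) z := fun k z =>
    gammaPDFReal_nonneg (by positivity) (by positivity) z
  have htail : Measurable fun z => gammaMeasure n r₂ (Ioi z) :=
    Antitone.measurable fun _ _ h => measure_mono (Ioi_subset_Ioi h)
  have hm : ∀ k : ℕ, Measurable fun z => gammaPDF (a + k) (r₁ + r₂) z * f z := fun k =>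
    (measurable_gammaPDF _ _).mul hf
  simp only [lintegral_gammaMeasure _ _ hf, ← lintegral_const_mul _ (hm _)]
  rw [lintegral_gammaMeasure _ _ (by fun_prop),
    ← lintegral_finsetSum _ fun k _ => (hm k).const_mul _]
  refine setLIntegral_congr_fun measurableSet_Ioi fun z (hz : 0 < z) => ?_
  rw [gammaMeasure_natCast_Ioi hn h₂ hz.le, mul_left_comm, gammaPDF,
    ← ENNReal.ofReal_mul (gammaPDFReal_nonneg ha h₁ z), gammaPDFReal_mul_erlangTail ha h₁ h₂ n hz,
    ENNReal.ofReal_sum_of_nonneg fun k _ => mul_nonneg (hw k) (hPDF k z), Finset.mul_sum]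
  refine Finset.sum_congr rfl fun k _ => ?_
  rw [gammaPDF, ENNReal.ofReal_mul (hw k)]
  ring

/-- The mixture of the laws `κ b` in which the gamma law with shape `n₁` and rate `r₁` competes with
the one with shape `n₂` and rate `r₂` and wins: given that exactly `k < n₂` of the `n₂` exponential
stages of the latter are over at that time, the law is `κ (n₁ + k)`. -/
def winnerMixture (κ : ℝ → Measure ℝ) (n₁ n₂ : ℕ) (r₁ r₂ : ℝ) : Measure ℝ :=
  ∑ k ∈ Finset.range n₂, ENNReal.ofReal (negBinomialWeight n₁ r₁ r₂ k) • κ (n₁ + k)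

lemma lintegral_winnerMixture (κ : ℝ → Measure ℝ) (n₁ n₂ : ℕ) (r₁ r₂ : ℝ) (f : ℝ → ENNReal) :
    ∫⁻ z, f z ∂winnerMixture κ n₁ n₂ r₁ r₂ = ∑ k ∈ Finset.range n₂,
      ENNReal.ofReal (negBinomialWeight n₁ r₁ r₂ k) * ∫⁻ z, f z ∂κ (n₁ + k) := by
  simp only [winnerMixture, lintegral_finsetSum_measure, lintegral_smul_measure, smul_eq_mul]

lemma lintegral_min_gammaMeasure {n₁ n₂ : ℕ} (hn₁ : 1 ≤ n₁) (hn₂ : 1 ≤ n₂) (h₁ : 0 < r₁)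
    (h₂ : 0 < r₂) {f : ℝ → ENNReal} (hf : Measurable f) :
    ∫⁻ p : ℝ × ℝ, f (min p.1 p.2) ∂(gammaMeasure n₁ r₁).prod (gammaMeasure n₂ r₂) =
      ∫⁻ z, f z ∂(winnerMixture (gammaMeasure · (r₁ + r₂)) n₁ n₂ r₁ r₂ +
        winnerMixture (gammaMeasure · (r₁ + r₂)) n₂ n₁ r₂ r₁) := by
  have hn₁' : (0 : ℝ) < n₁ := by exact_mod_cast hn₁
  have hn₂' : (0 : ℝ) < n₂ := by exact_mod_cast hn₂
  have := isProbabilityMeasure_gammaMeasure hn₁' h₁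
  have := isProbabilityMeasure_gammaMeasure hn₂' h₂
  simp only [lintegral_min_prod _ _ hf, gammaMeasure_Ici, lintegral_add_measure,
    lintegral_winnerMixture, lintegral_mul_gammaMeasure_Ioi hn₁' h₁ h₂ hn₂ hf,
    lintegral_mul_gammaMeasure_Ioi hn₂' h₂ h₁ hn₁ hf, add_comm r₂ r₁]

end MinLaw

section RatioLaw

/-- The density on `(0, ∞)` of the Lomax law (Pareto law of the second kind) with shape `b` and
scale `σ`. -/
def lomaxPDFReal (b σ w : ℝ) : ℝ := b / σ * (1 + w / σ) ^ (-(b + 1))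

/-- The Lomax law with shape `b` and scale `σ`. -/
def lomaxMeasure (b σ : ℝ) : Measure ℝ :=
  (volume.restrict (Ioi 0)).withDensity fun w => ENNReal.ofReal (lomaxPDFReal b σ w)

variable {b r s σ : ℝ}

lemma measurable_lomaxPDFReal (b σ : ℝ) : Measurable (lomaxPDFReal b σ) := by
  unfold lomaxPDFReal
  fun_prop

lemma lomaxPDFReal_nonneg (hb : 0 ≤ b) (hσ : 0 ≤ σ) {w : ℝ} (hw : 0 ≤ w) :
    0 ≤ lomaxPDFReal b σ w := by
  rw [lomaxPDFReal]
  positivity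

lemma gammaPDFReal_mul_exp (hb : 0 < b) (hs : 0 < s) (hr : 0 < r) {z w : ℝ} (hz : 0 < z)
    (hw : 0 < w) :
    gammaPDFReal b s z * (r * z * Real.exp (-(r * z * w))) =
      lomaxPDFReal b (s / r) w * gammaPDFReal (b + 1) (s + r * w) z := by
  have hΓ := (Real.Gamma_pos_of_pos hb).ne'
  have hsw : 0 < s + r * w := by positivity
  have := (Real.rpow_pos_of_pos hsw (b + 1)).ne'
  rw [gammaPDFReal, gammaPDFReal, if_pos hz.le, if_pos hz.le, lomaxPDFReal,
    Real.Gamma_add_one hb.ne',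
    show -((s + r * w) * z) = -(s * z) + -(r * z * w) by ring, Real.exp_add,
    show 1 + w / (s / r) = (s + r * w) / s by field_simp, Real.rpow_neg (by positivity),
    Real.div_rpow hsw.le hs.le, show b + 1 - 1 = b - 1 + 1 by ring, Real.rpow_add hz, Real.rpow_one,
    Real.rpow_add_one hs.ne']
  field_simp

lemma lintegral_comp_div_gammaMeasure_one (hr : 0 < r) {z : ℝ} (hz : 0 < z) {f : ℝ → ENNReal}
    (hf : Measurable f) :
    ∫⁻ p, f (p / z) ∂gammaMeasure 1 r =
      ∫⁻ w in Ioi 0, ENNReal.ofReal (r * z * Real.exp (-(r * z * w))) * f w := by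
  have := isProbabilityMeasure_gammaMeasure one_pos hr
  have hlaw := hasLaw_const_mul_gammaMeasure one_pos hr (inv_pos.2 hz)
    (HasLaw.id (μ := gammaMeasure 1 r))
  simp only [id_eq, div_inv_eq_mul, inv_mul_eq_div] at hlaw
  rw [hlaw.lintegral_comp hf.aemeasurable, lintegral_gammaMeasure _ _ hf]
  refine setLIntegral_congr_fun measurableSet_Ioi fun w (hw : 0 < w) => ?_
  simp [gammaPDF, gammaPDFReal, if_pos hw.le]

lemma measurable_lintegral_comp_div (μ : Measure ℝ) [SFinite μ] {f : ℝ → ENNReal}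
    (hf : Measurable f) : Measurable fun z => ∫⁻ p, f (p / z) ∂μ :=
  Measurable.lintegral_prod_right' (f := fun q : ℝ × ℝ => f (q.2 / q.1)) (by fun_prop)

lemma lintegral_div_gammaMeasure (hb : 0 < b) (hs : 0 < s) (hr : 0 < r) {f : ℝ → ENNReal}
    (hf : Measurable f) :
    ∫⁻ z, ∫⁻ p, f (p / z) ∂gammaMeasure 1 r ∂gammaMeasure b s =
      ∫⁻ w, f w ∂lomaxMeasure b (s / r) := by
  have := isProbabilityMeasure_gammaMeasure one_pos hr
  have hpdf := (measurable_lomaxPDFReal b (s / r)).ennreal_ofReal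
  have hm := measurable_gammaPDF b s
  calc _ = ∫⁻ z in Ioi 0, ∫⁻ w in Ioi 0,
        gammaPDF b s z * (ENNReal.ofReal (r * z * Real.exp (-(r * z * w))) * f w) := by
        rw [lintegral_gammaMeasure _ _ (measurable_lintegral_comp_div _ hf)]
        refine setLIntegral_congr_fun measurableSet_Ioi fun z hz => ?_
        rw [lintegral_comp_div_gammaMeasure_one hr hz hf, lintegral_const_mul _ (by fun_prop)]
    _ = ∫⁻ w in Ioi 0, ∫⁻ z in Ioi 0,
        gammaPDF b s z * (ENNReal.ofReal (r * z * Real.exp (-(r * z * w))) * f w) :=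
        lintegral_lintegral_swap (by fun_prop)
    _ = ∫⁻ w in Ioi 0, ENNReal.ofReal (lomaxPDFReal b (s / r) w) * f w := by
        refine setLIntegral_congr_fun measurableSet_Ioi fun w (hw : 0 < w) => ?_
        calc _ = ∫⁻ z in Ioi 0, ENNReal.ofReal (lomaxPDFReal b (s / r) w) * f w *
              gammaPDF (b + 1) (s + r * w) z := by
              refine setLIntegral_congr_fun measurableSet_Ioi fun z hz => ?_
              rw [gammaPDF, gammaPDF, ← mul_assoc,
                ← ENNReal.ofReal_mul (gammaPDFReal_nonneg hb hs z),
                gammaPDFReal_mul_exp hb hs hr hz hw, ENNReal.ofReal_mul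
                  (lomaxPDFReal_nonneg hb.le (by positivity) hw.le), mul_right_comm]
          _ = _ := by
              rw [lintegral_const_mul _ (measurable_gammaPDF _ _),
                setLIntegral_gammaPDF_Ioi (by positivity) (by positivity), mul_one]
    _ = ∫⁻ w, f w ∂lomaxMeasure b (s / r) :=
        (lintegral_withDensity_eq_lintegral_mul _ hpdf hf).symm

lemma isProbabilityMeasure_lomaxMeasure (hb : 0 < b) (hσ : 0 < σ) :
    IsProbabilityMeasure (lomaxMeasure b σ) := by
  have := isProbabilityMeasure_gammaMeasure one_pos one_pos
  have := isProbabilityMeasure_gammaMeasure hb hσ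
  constructor
  simpa using (lintegral_div_gammaMeasure hb hσ one_pos (f := 1) measurable_const).symm

variable {E : Type*} [MeasurableSpace E] {P : Measure E} [IsFiniteMeasure P]

theorem hasLaw_div_min_gammaMeasure {X U V : E → ℝ} {n₁ n₂ : ℕ} {r₁ r₂ : ℝ} (hr : 0 < r)
    (hn₁ : 1 ≤ n₁) (hn₂ : 1 ≤ n₂) (h₁ : 0 < r₁) (h₂ : 0 < r₂) (hX : HasLaw X (gammaMeasure 1 r) P)
    (hU : HasLaw U (gammaMeasure n₁ r₁) P) (hV : HasLaw V (gammaMeasure n₂ r₂) P)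
    (hUV : IndepFun U V P) (hXUV : IndepFun X (fun ω => (U ω, V ω)) P) :
    HasLaw (fun ω => X ω / min (U ω) (V ω))
      (winnerMixture (lomaxMeasure · ((r₁ + r₂) / r)) n₁ n₂ r₁ r₂ +
        winnerMixture (lomaxMeasure · ((r₁ + r₂) / r)) n₂ n₁ r₂ r₁) P := by
  have hn₁' : (0 : ℝ) < n₁ := by exact_mod_cast hn₁
  have hn₂' : (0 : ℝ) < n₂ := by exact_mod_cast hn₂
  have := isProbabilityMeasure_gammaMeasure one_pos hr
  have := isProbabilityMeasure_gammaMeasure hn₁' h₁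
  have := isProbabilityMeasure_gammaMeasure hn₂' h₂
  have hm : AEMeasurable (fun ω => X ω / min (U ω) (V ω)) P :=
    hX.aemeasurable.div (hU.aemeasurable.min hV.aemeasurable)
  have hjoint := hXUV.hasLaw_prod hX (hUV.hasLaw_prod hU hV)
  refine ⟨hm, Measure.ext_of_lintegral _ fun f hf => ?_⟩
  have hmix : ∀ n m : ℕ, 1 ≤ n → ∀ ρ₁ ρ₂ : ℝ,
      ∫⁻ z, ∫⁻ p, f (p / z) ∂gammaMeasure 1 r ∂winnerMixture (gammaMeasure · (r₁ + r₂)) n m ρ₁ ρ₂ =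
        ∫⁻ w, f w ∂winnerMixture (lomaxMeasure · ((r₁ + r₂) / r)) n m ρ₁ ρ₂ :=
    fun n m hn ρ₁ ρ₂ => by
      simp only [lintegral_winnerMixture]
      refine Finset.sum_congr rfl fun k _ => ?_
      rw [lintegral_div_gammaMeasure (by positivity) (add_pos h₁ h₂) hr hf]
  calc ∫⁻ w, f w ∂P.map (fun ω => X ω / min (U ω) (V ω))
      = ∫⁻ ω, f (X ω / min (U ω) (V ω)) ∂P := lintegral_map' hf.aemeasurable hm
    _ = ∫⁻ q : ℝ × ℝ × ℝ, f (q.1 / min q.2.1 q.2.2) ∂(gammaMeasure 1 r).prod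
        ((gammaMeasure n₁ r₁).prod (gammaMeasure n₂ r₂)) :=
        hjoint.lintegral_comp (f := fun q : ℝ × ℝ × ℝ => f (q.1 / min q.2.1 q.2.2))
          (by fun_prop)
    _ = ∫⁻ q : ℝ × ℝ, ∫⁻ p, f (p / min q.1 q.2) ∂gammaMeasure 1 r
        ∂(gammaMeasure n₁ r₁).prod (gammaMeasure n₂ r₂) := lintegral_prod_symm' _ (by fun_prop)
    _ = _ := by
        rw [lintegral_min_gammaMeasure hn₁ hn₂ h₁ h₂ (measurable_lintegral_comp_div _ hf),
          lintegral_add_measure, lintegral_add_measure, hmix n₁ n₂ hn₁, hmix n₂ n₁ hn₂]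

end RatioLaw

section Integrals

variable {b σ : ℝ}

lemma ae_lomaxMeasure_pos (b σ : ℝ) : ∀ᵐ w ∂lomaxMeasure b σ, 0 < w :=
  (withDensity_absolutelyContinuous _ _).ae_le (ae_restrict_mem measurableSet_Ioi)

lemma integral_lomaxMeasure (hb : 0 ≤ b) (hσ : 0 ≤ σ) (f : ℝ → ℝ) :
    ∫ w, f w ∂lomaxMeasure b σ = ∫ w in Ioi 0, lomaxPDFReal b σ w * f w := by
  rw [lomaxMeasure, integral_withDensity_eq_integral_toReal_smul
    (measurable_lomaxPDFReal b σ).ennreal_ofReal (ae_of_all _ fun _ => ENNReal.ofReal_lt_top)]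
  refine setIntegral_congr_fun measurableSet_Ioi fun w hw => ?_
  simp only [ENNReal.toReal_ofReal (lomaxPDFReal_nonneg hb hσ (le_of_lt hw)), smul_eq_mul]

lemma integrable_winnerMixture {κ : ℝ → Measure ℝ} (n₁ n₂ : ℕ) (r₁ r₂ : ℝ) {f : ℝ → ℝ}
    (hf : ∀ k : ℕ, Integrable f (κ (n₁ + k))) : Integrable f (winnerMixture κ n₁ n₂ r₁ r₂) :=
  integrable_finsetSum_measure.2 fun k _ => (hf k).smul_measure ENNReal.ofReal_ne_top

lemma integral_winnerMixture {κ : ℝ → Measure ℝ} {n₁ : ℕ} (hn₁ : 1 ≤ n₁) (n₂ : ℕ) {r₁ r₂ : ℝ}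
    (h₁ : 0 < r₁) (h₂ : 0 < r₂) {f : ℝ → ℝ} (hf : ∀ k : ℕ, Integrable f (κ (n₁ + k))) :
    ∫ z, f z ∂winnerMixture κ n₁ n₂ r₁ r₂ =
      ∑ k ∈ Finset.range n₂, negBinomialWeight n₁ r₁ r₂ k * ∫ z, f z ∂κ (n₁ + k) := by
  rw [winnerMixture, integral_finsetSum_measure fun k _ =>
    (hf k).smul_measure ENNReal.ofReal_ne_top]
  refine Finset.sum_congr rfl fun k _ => ?_
  rw [integral_smul_measure, smul_eq_mul,
    ENNReal.toReal_ofReal (negBinomialWeight_pos (by positivity) h₁ h₂ k).le]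

variable {a x y w : ℝ}

lemma inv_mul_innerDensity_mul_meijerG11 (ν : ℝ) (ha : 0 < a) (hx : 0 < x) (hy : 0 < y)
    (hw : 0 < w) :
    w⁻¹ * (innerDensity (1 - a) (ν - a) (-a) 0 y w * meijerG11 (1 + ν) 0 (x / w)) =
      Real.Gamma ν * Real.Gamma (-ν) * Real.Gamma a / y ^ a *
        (lomaxPDFReal a y w * ((w + x) / (w + 1)) ^ ν) := by
  have hwx : 1 + x / w = (w + x) / w := by field_simp
  have hwy : 1 + y / w = (w + y) / w := by field_simp
  have hyw : 1 + w / y = (w + y) / y := by rw [add_comm w]; field_simp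
  rw [innerDensity, meijerG11, meijerG11, meijerG11, lomaxPDFReal, hwx, hwy, hyw, Real.rpow_zero,
    Real.rpow_zero, show 1 - (1 - a) + (ν - a) = ν by ring, show 1 - (1 + ν) + 0 = -ν by ring,
    show 1 - -a + 0 = a + 1 by ring, Real.Gamma_add_one ha.ne', neg_neg, add_comm 1 w,
    Real.rpow_sub hw, Real.div_rpow (by positivity) hw.le, Real.div_rpow (by positivity) hw.le,
    Real.div_rpow (by positivity) hy.le, Real.div_rpow (by positivity) (by positivity),
    Real.rpow_neg (add_pos hw one_pos).le, Real.rpow_neg hw.le, Real.rpow_neg hy.le,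
    Real.rpow_neg (add_pos hw hy).le, Real.rpow_add_one hw.ne', Real.rpow_add_one hy.ne']
  have := Real.rpow_pos_of_pos hw ν
  have := Real.rpow_pos_of_pos hw a
  have := Real.rpow_pos_of_pos hy a
  field_simp

lemma meijerG11Convolution_eq_integral_lomaxMeasure (ν : ℝ) (ha : 0 < a) (hx : 0 < x)
    (hy : 0 < y) :
    meijerG11Convolution (1 - a) (ν - a) (1 + ν) 0 (-a) 0 x y =
      Real.Gamma ν * Real.Gamma (-ν) * Real.Gamma a / y ^ a *
        ∫ w, ((w + x) / (w + 1)) ^ ν ∂lomaxMeasure a y := by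
  rw [meijerG11Convolution, integral_lomaxMeasure ha.le hy.le, ← integral_const_mul]
  exact setIntegral_congr_fun measurableSet_Ioi fun w hw =>
    inv_mul_innerDensity_mul_meijerG11 ν ha hx hy hw

end Integrals

namespace NOMAParams

variable (S : NOMAParams)

lemma natCast_K_pos : (0 : ℝ) < S.K := Nat.cast_pos.2 S.K_pos

lemma pairBandwidth_pos : 0 < S.pairBandwidth :=
  div_pos (mul_pos two_pos S.B_pos) S.natCast_K_pos

lemma ν_pos : 0 < S.ν :=
  div_pos (mul_pos (mul_pos S.θ_pos S.T_pos) S.pairBandwidth_pos) (Real.log_pos one_lt_two)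

lemma Ihat_pos : 0 < S.Ihat := div_pos S.I_pos (mul_pos S.N₀_pos S.pairBandwidth_pos)

lemma Ω_pos : 0 < S.Ω := div_pos (mul_pos S.Ωn_pos S.Ωf_pos) (add_pos S.Ωn_pos S.Ωf_pos)

lemma argX_pos : 0 < S.argX := mul_pos (half_pos S.natCast_K_pos) S.as_pos

lemma argX_lt_one : S.argX < 1 := by
  have has : S.as < 1 / S.K := by
    linarith [S.as_lt_aw, S.as_add_aw, show (2 : ℝ) / S.K = 2 * (1 / S.K) by ring]
  rw [lt_div_iff₀ S.natCast_K_pos] at has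
  rw [argX]
  linarith [S.natCast_K_pos]

lemma argY_pos : 0 < S.argY :=
  div_pos (mul_pos S.natCast_K_pos S.Ωp_pos) (mul_pos (mul_pos two_pos S.Ω_pos) S.Ihat_pos)

lemma ν_ne_intCast (hν : ∀ n : ℕ, S.ν ≠ n) (n : ℤ) : S.ν ≠ n := by
  intro h
  lift n to ℕ using by exact_mod_cast (h ▸ S.ν_pos).le
  exact hν n (by exact_mod_cast h)

lemma isEGBMGF (hν : ∀ n : ℕ, S.ν ≠ n) {a : ℕ} (ha : 1 ≤ a) :
    IsEGBMGF (S.blk₁ a) S.blk₂ (NOMAParams.blk₃ a) S.argX S.argY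
      (meijerG11Convolution (1 - a) (S.ν - a) (1 + S.ν) 0 (-a) 0 S.argX S.argY) := by
  have ha' : (0 : ℝ) < a := by exact_mod_cast ha
  have := S.ν_pos
  refine isEGBMGF_block11 (by linarith) (by linarith) (fun n hn => ?_) (by linarith) (by linarith)
    S.argX_pos S.argY_pos
  exact S.ν_ne_intCast hν (-1 - n) (by push_cast; linarith)

/-- The rate of the exponential law of `K g_p / (2 Î)`. -/
def scaledGainRate : ℝ := 1 / S.Ωp / (S.K / (2 * S.Ihat))

lemma scaledGainRate_pos : 0 < S.scaledGainRate :=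
  div_pos (one_div_pos.2 S.Ωp_pos) (div_pos S.natCast_K_pos (mul_pos two_pos S.Ihat_pos))

lemma add_eq_scaledGainRate_mul_argY :
    1 / S.Ωn + 1 / S.Ωf = S.scaledGainRate * S.argY := by
  have := S.natCast_K_pos
  have := S.Ihat_pos
  have := S.Ωp_pos
  have := S.Ωn_pos
  have := S.Ωf_pos
  rw [scaledGainRate, argY, Ω]
  field_simp
  ring

/-- `(1 + γ_w) ^ (-ν)` as a function of `w = K g_p / (2 Î g_w)`. -/
def rateKernel (w : ℝ) : ℝ := ((w + S.argX) / (w + 1)) ^ S.ν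

lemma measurable_rateKernel : Measurable S.rateKernel := by
  unfold rateKernel
  fun_prop

lemma rateKernel_mem_Ioc {w : ℝ} (hw : 0 < w) : S.rateKernel w ∈ Ioc 0 1 := by
  have hx := S.argX_pos
  refine ⟨Real.rpow_pos_of_pos (by positivity) _,
    Real.rpow_le_one (by positivity) ?_ S.ν_pos.le⟩
  rw [div_le_one (by positivity)]
  linarith [S.argX_lt_one]

lemma integrable_rateKernel {P : Measure ℝ} [IsFiniteMeasure P] (hP : ∀ᵐ w ∂P, 0 < w) :
    Integrable S.rateKernel P := by
  refine .of_bound S.measurable_rateKernel.aestronglyMeasurable 1 ?_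
  filter_upwards [hP] with w hw
  obtain ⟨hpos, hle⟩ := S.rateKernel_mem_Ioc hw
  rwa [Real.norm_of_nonneg hpos.le]

lemma integral_rateKernel_pos {P : Measure ℝ} [IsProbabilityMeasure P] (hP : ∀ᵐ w ∂P, 0 < w) :
    0 < ∫ w, S.rateKernel w ∂P := by
  have hpos : ∀ᵐ w ∂P, 0 < S.rateKernel w := hP.mono fun w hw => (S.rateKernel_mem_Ioc hw).1
  rw [integral_pos_iff_support_of_nonneg_ae (hpos.mono fun _ => le_of_lt)
    (S.integrable_rateKernel hP)]
  have hsupp : P (Function.support S.rateKernel) = 1 :=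
    (mem_ae_iff_prob_eq_one (measurableSet_support S.measurable_rateKernel)).1
      (hpos.mono fun _ => ne_of_gt)
  exact hsupp ▸ one_pos

lemma integrable_rateKernel_lomaxMeasure {b : ℝ} (hb : 0 < b) :
    Integrable S.rateKernel (lomaxMeasure b S.argY) :=
  have := isProbabilityMeasure_lomaxMeasure hb S.argY_pos
  S.integrable_rateKernel (ae_lomaxMeasure_pos _ _)

/-- The law of `K g_p / (2 Î g_w)` restricted to the event that the user with `α₁` antennas and path
loss `β₁` is the weak one. -/
def ratioBranch (α₁ α₂ : ℕ) (β₁ β₂ : ℝ) : Measure ℝ :=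
  winnerMixture (lomaxMeasure · S.argY) α₁ α₂ (1 / β₁) (1 / β₂)

variable {α₁ α₂ : ℕ} {β₁ β₂ : ℝ}

lemma integrable_rateKernel_ratioBranch (h₁ : 1 ≤ α₁) :
    Integrable S.rateKernel (S.ratioBranch α₁ α₂ β₁ β₂) :=
  integrable_winnerMixture _ _ _ _ fun _ => S.integrable_rateKernel_lomaxMeasure (by positivity)

lemma integral_rateKernel_ratioBranch (h₁ : 1 ≤ α₁) (hβ₁ : 0 < β₁) (hβ₂ : 0 < β₂) :
    ∫ w, S.rateKernel w ∂S.ratioBranch α₁ α₂ β₁ β₂ =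
      ∑ τ ∈ Finset.range α₂, negBinomialWeight α₁ (1 / β₁) (1 / β₂) τ *
        ∫ w, S.rateKernel w ∂lomaxMeasure (α₁ + τ) S.argY :=
  integral_winnerMixture h₁ _ (one_div_pos.2 hβ₁) (one_div_pos.2 hβ₂)
    fun _ => S.integrable_rateKernel_lomaxMeasure (by positivity)

lemma integral_rateKernel_ratioBranch_pos (h₁ : 1 ≤ α₁) (h₂ : 1 ≤ α₂) (hβ₁ : 0 < β₁)
    (hβ₂ : 0 < β₂) : 0 < ∫ w, S.rateKernel w ∂S.ratioBranch α₁ α₂ β₁ β₂ := by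
  rw [S.integral_rateKernel_ratioBranch h₁ hβ₁ hβ₂]
  refine Finset.sum_pos (fun τ _ => ?_) (Finset.nonempty_range_iff.2 (by lia))
  have := isProbabilityMeasure_lomaxMeasure (show (0 : ℝ) < α₁ + τ by positivity) S.argY_pos
  exact mul_pos (negBinomialWeight_pos (by positivity) (one_div_pos.2 hβ₁) (one_div_pos.2 hβ₂) τ)
    (S.integral_rateKernel_pos (ae_lomaxMeasure_pos _ _))

lemma T₃_coeff_mul_eq_negBinomialWeight (hν : ∀ n : ℕ, S.ν ≠ n) (h₁ : 1 ≤ α₁) (hβ₁ : 0 < β₁)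
    (hβ₂ : 0 < β₂) (hβ : 1 / β₁ + 1 / β₂ = S.scaledGainRate * S.argY) (τ : ℕ) :
    S.Ωp ^ (α₁ + τ) * ((2 * S.Ihat / S.K) ^ (α₁ + τ))⁻¹ /
        (Real.Gamma α₁ * Real.Gamma S.ν * Real.Gamma (-S.ν) * β₁ ^ α₁ * β₂ ^ τ * τ.factorial) *
      (Real.Gamma S.ν * Real.Gamma (-S.ν) * Real.Gamma (α₁ + τ) / S.argY ^ (α₁ + τ)) =
        negBinomialWeight α₁ (1 / β₁) (1 / β₂) τ := by
  have hΓ : Real.Gamma S.ν ≠ 0 := (Real.Gamma_pos_of_pos S.ν_pos).ne'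
  have hΓ' : Real.Gamma (-S.ν) ≠ 0 := Real.Gamma_ne_zero fun k hk => hν k (by linarith)
  have hΓα : Real.Gamma α₁ ≠ 0 := (Real.Gamma_pos_of_pos (by positivity)).ne'
  have hK := S.natCast_K_pos
  have hI := S.Ihat_pos
  have hp := S.Ωp_pos
  have hy := S.argY_pos
  rw [negBinomialWeight, hβ, scaledGainRate, Real.rpow_natCast]
  simp only [div_pow, mul_pow, one_pow, pow_add]
  field_simp

lemma T₃_eq_integral (hν : ∀ n : ℕ, S.ν ≠ n) (h₁ : 1 ≤ α₁) (hβ₁ : 0 < β₁) (hβ₂ : 0 < β₂)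
    (hβ : 1 / β₁ + 1 / β₂ = S.scaledGainRate * S.argY) :
    S.T₃ α₁ α₂ β₁ β₂ = ↑(∫ w, S.rateKernel w ∂S.ratioBranch α₁ α₂ β₁ β₂) := by
  rw [T₃, S.integral_rateKernel_ratioBranch h₁ hβ₁ hβ₂, ofReal_sum]
  refine Finset.sum_congr rfl fun τ _ => ?_
  rw [(S.isEGBMGF hν (by lia)).egbmgf_eq, ← ofReal_mul,
    meijerG11Convolution_eq_integral_lomaxMeasure S.ν (by positivity) S.argX_pos S.argY_pos,
    Real.rpow_natCast, ← mul_assoc, Nat.cast_add,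
    S.T₃_coeff_mul_eq_negBinomialWeight hν h₁ hβ₁ hβ₂ hβ]
  rfl

end NOMAParams

section Independence

variable {E : Type*} [MeasurableSpace E] {P : Measure E}

lemma indepFun_precomp_precomp {ι κ₁ κ₂ 𝓧 : Type*} [Finite κ₁] [Finite κ₂] [MeasurableSpace 𝓧]
    {f : ι → E → 𝓧} (hf : iIndepFun f P) (hm : ∀ i, AEMeasurable (f i) P) {g₁ : κ₁ → ι}
    {g₂ : κ₂ → ι} (hg : ∀ i j, g₁ i ≠ g₂ j) :
    IndepFun (fun ω i => f (g₁ i) ω) (fun ω j => f (g₂ j) ω) P := by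
  classical
  cases nonempty_fintype κ₁
  cases nonempty_fintype κ₂
  have hdisj : Disjoint (Finset.univ.image g₁) (Finset.univ.image g₂) := by
    simpa [Finset.disjoint_left] using fun i j => (hg i j).symm
  exact (hf.indepFun_finset₀ _ _ hdisj hm).comp
    (φ := fun v i => v ⟨g₁ i, Finset.mem_image_of_mem _ (Finset.mem_univ i)⟩)
    (ψ := fun v j => v ⟨g₂ j, Finset.mem_image_of_mem _ (Finset.mem_univ j)⟩)
    (by fun_prop) (by fun_prop)

end Independence

namespace RayleighFading

variable {S : NOMAParams} {E : Type*} [MeasurableSpace E] {μ : Measure E}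
  (F : RayleighFading S μ)

lemma aemeasurable_coeff (j : Unit ⊕ (Fin S.Nn ⊕ Fin S.Nf)) :
    AEMeasurable (Sum.elim (fun _ => F.hp) (Sum.elim F.hn F.hf) j) μ := by
  rcases j with _ | j | j
  · exact F.law_hp.aemeasurable
  · exact (F.law_hn j).aemeasurable
  · exact (F.law_hf j).aemeasurable

lemma indepFun_gn_gf : IndepFun F.gn F.gf μ := by
  have hm : ∀ {N : ℕ} {Ω : ℝ}, Measurable fun v : Fin N → ℂ => ∑ i, ‖(√Ω : ℂ) * v i‖ ^ 2 := by
    fun_prop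
  exact (indepFun_precomp_precomp F.indep F.aemeasurable_coeff (g₁ := fun i => .inr (.inl i))
    (g₂ := fun i => .inr (.inr i)) (by simp)).comp hm hm

lemma indepFun_gp_gn_gf : IndepFun F.gp (fun ω => (F.gn ω, F.gf ω)) μ := by
  have hp : Measurable fun v : Unit → ℂ => ‖(√S.Ωp : ℂ) * v ()‖ ^ 2 := by fun_prop
  have hnf : Measurable fun v : Fin S.Nn ⊕ Fin S.Nf → ℂ =>
      (∑ i, ‖(√S.Ωn : ℂ) * v (.inl i)‖ ^ 2, ∑ i, ‖(√S.Ωf : ℂ) * v (.inr i)‖ ^ 2) := by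
    fun_prop
  exact (indepFun_precomp_precomp F.indep F.aemeasurable_coeff (g₁ := .inl) (g₂ := .inr)
    (by simp)).comp hp hnf

lemma one_add_γw_rpow_eq_rateKernel {ω : E} (hp : 0 < F.gp ω) (hw : 0 < F.gw ω) :
    (1 + F.γw ω) ^ (-S.ν) = S.rateKernel (S.K / (2 * S.Ihat) * F.gp ω / F.gw ω) := by
  have hK := S.natCast_K_pos
  have hI := S.I_pos
  have hN := S.N₀_pos
  have hB := S.pairBandwidth_pos
  have has := S.as_pos
  have haw : S.aw = 2 / S.K - S.as := eq_sub_of_add_eq' S.as_add_aw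
  have hIhat := S.Ihat_pos
  set w := S.K / (2 * S.Ihat) * F.gp ω / F.gw ω with hw_def
  have hx := S.argX_pos
  have hγ : 1 + F.γw ω = ((w + S.argX) / (w + 1))⁻¹ := by
    have hnoise : 0 < S.N₀ * S.pairBandwidth + S.as * S.I * F.gw ω / F.gp ω := by positivity
    have hwx : 0 < w + S.argX := by positivity
    rw [inv_div, eq_div_iff hwx.ne', γw, one_add_div hnoise.ne', div_mul_eq_mul_div,
      div_eq_iff hnoise.ne', haw, hw_def, NOMAParams.argX, NOMAParams.Ihat]
    field_simp
    ring
  rw [hγ, Real.inv_rpow (by positivity), Real.rpow_neg (by positivity), inv_inv,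
    NOMAParams.rateKernel]

variable [IsProbabilityMeasure μ]

lemma hasLaw_gp : HasLaw F.gp (gammaMeasure 1 (1 / S.Ωp)) μ := hasLaw_gain F.law_hp S.Ωp_pos

lemma hasLaw_gn : HasLaw F.gn (gammaMeasure S.Nn (1 / S.Ωn)) μ := by
  have := Fin.pos_iff_nonempty.1 S.Nn_pos
  have hind : iIndepFun F.hn μ :=
    F.indep.precomp (g := fun i => .inr (.inl i)) (Sum.inr_injective.comp Sum.inl_injective)
  have h := hasLaw_sum_gain F.law_hn hind S.Ωn_pos
  rwa [Fintype.card_fin] at h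

lemma hasLaw_gf : HasLaw F.gf (gammaMeasure S.Nf (1 / S.Ωf)) μ := by
  have := Fin.pos_iff_nonempty.1 S.Nf_pos
  have hind : iIndepFun F.hf μ :=
    F.indep.precomp (g := fun i => .inr (.inr i)) (Sum.inr_injective.comp Sum.inr_injective)
  have h := hasLaw_sum_gain F.law_hf hind S.Ωf_pos
  rwa [Fintype.card_fin] at h

lemma ae_gp_pos : ∀ᵐ ω ∂μ, 0 < F.gp ω :=
  (F.hasLaw_gp.ae_iff (measurable_const.lt measurable_id)).2 (ae_gammaMeasure_pos _ _)

lemma ae_gw_pos : ∀ᵐ ω ∂μ, 0 < F.gw ω := by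
  filter_upwards [(F.hasLaw_gn.ae_iff (measurable_const.lt measurable_id)).2
      (ae_gammaMeasure_pos _ _),
    (F.hasLaw_gf.ae_iff (measurable_const.lt measurable_id)).2 (ae_gammaMeasure_pos _ _)]
    with ω hn hf using lt_min hn hf

lemma hasLaw_scaledRatio :
    HasLaw (fun ω => S.K / (2 * S.Ihat) * F.gp ω / F.gw ω)
      (S.ratioBranch S.Nn S.Nf S.Ωn S.Ωf + S.ratioBranch S.Nf S.Nn S.Ωf S.Ωn) μ := by
  have hκ : 0 < S.K / (2 * S.Ihat) := div_pos S.natCast_K_pos (mul_pos two_pos S.Ihat_pos)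
  have hgp : HasLaw (fun ω => S.K / (2 * S.Ihat) * F.gp ω) (gammaMeasure 1 S.scaledGainRate) μ :=
    hasLaw_const_mul_gammaMeasure one_pos (one_div_pos.2 S.Ωp_pos) hκ F.hasLaw_gp
  have hind : IndepFun (fun ω => S.K / (2 * S.Ihat) * F.gp ω) (fun ω => (F.gn ω, F.gf ω)) μ :=
    F.indepFun_gp_gn_gf.comp (measurable_const_mul _) measurable_id
  have h := hasLaw_div_min_gammaMeasure S.scaledGainRate_pos S.Nn_pos S.Nf_pos
    (one_div_pos.2 S.Ωn_pos) (one_div_pos.2 S.Ωf_pos) hgp F.hasLaw_gn F.hasLaw_gf F.indepFun_gn_gf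
    hind
  rwa [S.add_eq_scaledGainRate_mul_argY, mul_div_cancel_left₀ _ S.scaledGainRate_pos.ne'] at h

lemma integral_one_add_γw_rpow :
    ∫ ω, (1 + F.γw ω) ^ (-S.ν) ∂μ =
      ∫ w, S.rateKernel w ∂S.ratioBranch S.Nn S.Nf S.Ωn S.Ωf +
        ∫ w, S.rateKernel w ∂S.ratioBranch S.Nf S.Nn S.Ωf S.Ωn := by
  rw [← integral_add_measure (S.integrable_rateKernel_ratioBranch S.Nn_pos)
      (S.integrable_rateKernel_ratioBranch S.Nf_pos),
    ← F.hasLaw_scaledRatio.integral_comp S.measurable_rateKernel.aestronglyMeasurable]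
  refine integral_congr_ae ?_
  filter_upwards [F.ae_gp_pos, F.ae_gw_pos] with ω hp hw using
    F.one_add_γw_rpow_eq_rateKernel hp hw

end RayleighFading

end

theorem theorem2 (S : NOMAParams) (hν : ∀ n : ℕ, S.ν ≠ n)
    {E : Type*} [MeasurableSpace E] (μ : Measure E) [IsProbabilityMeasure μ]
    (F : RayleighFading S μ) :
    (∀ τ < S.Nf, ∃ v, IsEGBMGF (S.blk₁ (S.Nn + τ)) S.blk₂ (NOMAParams.blk₃ (S.Nn + τ)) S.argX S.argY v) ∧
    (∀ τ < S.Nn, ∃ v, IsEGBMGF (S.blk₁ (S.Nf + τ)) S.blk₂ (NOMAParams.blk₃ (S.Nf + τ)) S.argX S.argY v) ∧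
    (S.T₃ S.Nn S.Nf S.Ωn S.Ωf).im = 0 ∧ (S.T₃ S.Nf S.Nn S.Ωf S.Ωn).im = 0 ∧
    0 < (S.T₃ S.Nn S.Nf S.Ωn S.Ωf + S.T₃ S.Nf S.Nn S.Ωf S.Ωn).re ∧
    F.Rw = -1 / S.ν *
      Real.logb 2 (S.T₃ S.Nn S.Nf S.Ωn S.Ωf + S.T₃ S.Nf S.Nn S.Ωf S.Ωn).re := by
  have hT₁ := S.T₃_eq_integral (α₂ := S.Nf) hν S.Nn_pos S.Ωn_pos S.Ωf_pos
    S.add_eq_scaledGainRate_mul_argY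
  have hT₂ := S.T₃_eq_integral (α₂ := S.Nn) hν S.Nf_pos S.Ωf_pos S.Ωn_pos
    ((add_comm _ _).trans S.add_eq_scaledGainRate_mul_argY)
  have hpos₁ := S.integral_rateKernel_ratioBranch_pos S.Nn_pos S.Nf_pos S.Ωn_pos S.Ωf_pos
  have hpos₂ := S.integral_rateKernel_ratioBranch_pos S.Nf_pos S.Nn_pos S.Ωf_pos S.Ωn_pos
  refine ⟨fun _ _ => ⟨_, S.isEGBMGF hν (Nat.le_add_right_of_le S.Nn_pos)⟩,
    fun _ _ => ⟨_, S.isEGBMGF hν (Nat.le_add_right_of_le S.Nf_pos)⟩, ?_⟩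
  rw [hT₁, hT₂, ← Complex.ofReal_add, Complex.ofReal_re, RayleighFading.Rw,
    F.integral_one_add_γw_rpow]
  exact ⟨Complex.ofReal_im _, Complex.ofReal_im _, add_pos hpos₁ hpos₂, rfl⟩
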